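/- Let $t\ge 1$ and let $\mathcal S_1,\dots,\mathcal S_t$ be pairwise disjoint non-empty subsets of $[N]=\{1,\dots,N\}$; put $\ell_j=|\mathcal S_j|$ and $\ell=\sum_{j=1}^t\ell_j$. A permutation $\sigma$ of $[N]$ is said to separate $\mathcal S_1,\dots,\mathcal S_t$ if no cycle of $\sigma$ contains elements of two different sets $\mathcal S_i,\mathcal S_j$. Let $p(N,\vec\ell;2)$ be the probability that $\sigma=p_1p_2$ separates $\mathcal S_1,\dots,\mathcal S_t$, where $p_1,p_2$ are independent and uniformly distributed on the $(N-1)!$ maximal cycles (cycles of length $N$) of $[N]$. Then $$p(N,\vec\ell;2)=\frac{(-1)^{N+\ell}\,N\prod_{j=1}^t\ell_j!}{(N)_\ell}\;[z^{N-\ell}]\,(1-z)^{-t+1}\int_0^1\frac{(1-u)^{N+1}u^{\ell-t}}{(1-u+zu)^{\ell+1}}\,du,$$ where $(N)_\ell=N(N-1)\cdots(N-\ell+1)$. Here the integral converges for every real $z\ge 0$, and $[z^{N-\ell}]$ is the coefficient of $z^{N-\ell}$ in the Taylor expansion $a_0+a_1z+\dots+a_{N-\ell}z^{N-\ell}+o(z^{N-\ell})$,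 as $z\to0$ with $z\ge 0$, of the function to its right; such an expansion exists. The same coefficient is obtained formally, by expanding the integrand into powers of $z$ and integrating coefficient by coefficient (the integrals of the coefficients of $z^r$ converge for all $r\le N-\ell$), and then multiplying by the power series of $(1-z)^{-t+1}$. -/

import Mathlib

open scoped PowerSeries Topology

/-- The maximal cycles of `S_N`: the permutations of `{0, …, N-1}` with a single cycle, of length
`N` (for `N = 1` this is the identity). -/
noncomputable def maximalCycles (N : ℕ) : Finset (Equiv.Perm (Fin N)) :=
  open scoped Classical in Finset.univ.filter fun p => p.IsCycleOn Set.univ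

/-- `σ` separates the sets `S j`: no cycle of `σ` contains elements of two different ones. -/
def Separates {N t : ℕ} (σ : Equiv.Perm (Fin N)) (S : Fin t → Finset (Fin N)) : Prop :=
  ∀ i j, i ≠ j → ∀ x ∈ S i, ∀ y ∈ S j, ¬ σ.SameCycle x y

/-- The probability that `p₁ * p₂` separates the sets `S j`, when `p₁`, `p₂` are independent
uniformly random maximal cycles, i.e. when `(p₁, p₂)` is uniform on the pairs of maximal cycles. -/
noncomputable def separationProb {N t : ℕ} (S : Fin t → Finset (Fin N)) : ℝ :=
  open scoped Classical in
  (((maximalCycles N ×ˢ maximalCycles N).filter fun p => Separates (p.1 * p.2) S).card : ℝ) /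
    ((maximalCycles N ×ˢ maximalCycles N).card : ℝ)

/-- The integrand `(1-u)^(N+1) u^(ℓ-t) / (1-u+zu)^(ℓ+1)` at real `z` and `u` (used for `t ≤ ℓ`). -/
noncomputable def sepIntegrand (N ℓ t : ℕ) (z u : ℝ) : ℝ :=
  (1 - u) ^ (N + 1) * u ^ (ℓ - t) / (1 - u + z * u) ^ (ℓ + 1)

/-- The same integrand as a formal power series in `z`, for fixed `u ≠ 1` (at `u = 1` the
denominator is not invertible as a power series; this single point does not affect integrals). -/
noncomputable def sepIntegrandSeries (N ℓ t : ℕ) (u : ℝ) : ℝ⟦X⟧ :=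
  PowerSeries.C ((1 - u) ^ (N + 1) * u ^ (ℓ - t)) *
    ((PowerSeries.C (1 - u) + PowerSeries.C u * PowerSeries.X) ^ (ℓ + 1))⁻¹

/-- The integral over `u ∈ [0,1]` of the integrand, as a formal power series in `z`
(integrated coefficient by coefficient). -/
noncomputable def sepIntegralSeries (N ℓ t : ℕ) : ℝ⟦X⟧ :=
  PowerSeries.mk fun r => ∫ u in (0 : ℝ)..1, PowerSeries.coeff r (sepIntegrandSeries N ℓ t u)

/-- `c = [z^m] F(z)` for a function `F` of a real variable `z ≥ 0`: the (unique) coefficient of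
`z^m` in the Taylor expansion `F(z) = a₀ + a₁ z + ⋯ + a_m z^m + o(z^m)` as `z → 0`, `z ≥ 0`. -/
def HasRightTaylorCoeff (F : ℝ → ℝ) (m : ℕ) (c : ℝ) : Prop :=
  ∃ a : ℕ → ℝ, a m = c ∧
    (fun z : ℝ => F z - ∑ r ∈ Finset.range (m + 1), a r * z ^ r) =o[𝓝[≥] 0] fun z : ℝ => z ^ m

/-! Fix a marked point `b`. For a set A of points other than `b`, with B the remaining ones, let H_A
be the hook symmetrizer ∑ sgn(c) cρ, c ranging over Sym(A ∪ {b}) and ρ over Sym(B ∪ {b}); `hookSum`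
is a test function summed against it. Let K be the class sum of the maximal cycles. Two identities
replace character theory: N·K = ∑_A (-1)^|A| H_A (`sum_hookSum`) and K·H_A = (-1)^|A| |A|! |B|! H_A
(`sum_cyclesOn_hookSum`). Hence N·K² = ∑_A |A|! |B|! H_A (`sum_sum_cyclesOn`), and the Beta integral
|A|! |B|! = N! ∫ (1-u)^|A| u^|B| du makes the weights multiplicative.

The separation indicator is summed against H_A by adding points to A and B one at a time; each
addition multiplies the value by a scalar. A marked point gives 1-k or 1+k, where k counts the
points of its block already in A ∪ {b}, respectively B ∪ {b}; an unmarked point gives -|A| or |B|+2.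
The factor 1-1 kills every A for which A ∪ {b} has two points in one block, so the sum over A
becomes a product over the blocks times binomial series for the unmarked points. With x = 1-u and y
= u, the identity x/(1+xX) + y/(1-yX) = 1/((1+xX)(1-yX)) collapses it, up to factorials, to u^(ℓ-t)
[X^(N-ℓ)] (1+xX)^(-(t-1)) (1-yX)^(-(ℓ+1)) (`sum_hookSum_sepIndicator`). Rescaling X gives the stated
integrand.

For the coefficient as a Taylor coefficient in real z, put m = N-ℓ and w = zu/(1-u): the integrand
is u^(ℓ-t) (1-u)^m (1+w)^(-(ℓ+1)). The integral of its coefficient of z^(m+1) diverges at u = 1, so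
the remainder is bounded by the intermediate power w^(m+1/2); the singularity (1-u)^(-1/2) is
integrable and the error is O(z^(m+1/2)). -/

open Equiv

set_option linter.unusedSectionVars false

/-! ### Permutations supported on a set, and insertion of a point into a cycle. -/

section PermsOn

variable {α β : Type*} [Fintype α] [DecidableEq α]

/-- The permutations that fix every point outside `F`. -/
def permsOn (F : Finset α) : Finset (Perm α) :=
  Finset.univ.filter fun σ => ∀ x, x ∉ F → σ x = x

lemma mem_permsOn {F : Finset α} {σ : Perm α} : σ ∈ permsOn F ↔ ∀ x, x ∉ F → σ x = x := by
  simp [permsOn]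

lemma permsOn_mono {F G : Finset α} (h : F ⊆ G) : permsOn F ⊆ permsOn G := by
  intro σ hσ
  rw [mem_permsOn] at *
  exact fun x hx => hσ x fun hF => hx (h hF)

lemma one_mem_permsOn (F : Finset α) : (1 : Perm α) ∈ permsOn F := by simp [mem_permsOn]

lemma mul_mem_permsOn {F : Finset α} {σ τ : Perm α} (hσ : σ ∈ permsOn F) (hτ : τ ∈ permsOn F) :
    σ * τ ∈ permsOn F := by
  rw [mem_permsOn] at *
  intro x hx
  rw [Perm.mul_apply, hτ x hx, hσ x hx]

lemma inv_mem_permsOn {F : Finset α} {σ : Perm α} (hσ : σ ∈ permsOn F) : σ⁻¹ ∈ permsOn F := by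
  rw [mem_permsOn] at *
  intro x hx
  rw [Perm.inv_eq_iff_eq, hσ x hx]

lemma swap_mem_permsOn {F : Finset α} {a b : α} (ha : a ∈ F) (hb : b ∈ F) :
    swap a b ∈ permsOn F := by
  rw [mem_permsOn]
  intro x hx
  exact swap_apply_of_ne_of_ne (fun h => hx (h ▸ ha)) fun h => hx (h ▸ hb)

lemma apply_mem_of_mem_permsOn {F : Finset α} {σ : Perm α} (hσ : σ ∈ permsOn F) {x : α}
    (hx : x ∈ F) : σ x ∈ F := by
  by_contra h
  have h1 := mem_permsOn.1 hσ _ h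
  exact h (by rwa [σ.injective h1])

lemma permsOn_singleton (b : α) : permsOn {b} = {1} := by
  ext σ
  refine ⟨fun h => ?_, fun h => ?_⟩
  · rw [Finset.mem_singleton]
    ext x
    by_cases hx : x ∈ ({b} : Finset α)
    · have := apply_mem_of_mem_permsOn h hx
      simp_all
    · simpa using mem_permsOn.1 h x hx
  · rw [Finset.mem_singleton.1 h]
    exact one_mem_permsOn _

lemma sum_comp_permsOn [AddCommMonoid β] {F : Finset α} {σ : Perm α} (hσ : σ ∈ permsOn F)
    (f : α → β) : ∑ a ∈ F, f (σ a) = ∑ a ∈ F, f a :=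
  Finset.sum_nbij' σ (σ⁻¹ : Perm α) (fun _ h => apply_mem_of_mem_permsOn hσ h)
    (fun _ h => apply_mem_of_mem_permsOn (inv_mem_permsOn hσ) h) (by simp) (by simp) (by simp)

lemma sum_inv_permsOn [AddCommMonoid β] (F : Finset α) (f : Perm α → β) :
    ∑ σ ∈ permsOn F, f σ⁻¹ = ∑ σ ∈ permsOn F, f σ :=
  Finset.sum_nbij' (·⁻¹) (·⁻¹) (fun _ h => inv_mem_permsOn h) (fun _ h => inv_mem_permsOn h)
    (by simp) (by simp) (by simp)

lemma sum_mul_left_permsOn [AddCommMonoid β] {F : Finset α} {τ : Perm α} (hτ : τ ∈ permsOn F)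
    (f : Perm α → β) : ∑ σ ∈ permsOn F, f (τ * σ) = ∑ σ ∈ permsOn F, f σ :=
  Finset.sum_nbij' (τ * ·) (τ⁻¹ * ·) (fun _ h => mul_mem_permsOn hτ h)
    (fun _ h => mul_mem_permsOn (inv_mem_permsOn hτ) h) (by simp) (by simp) (by simp)

lemma sum_mul_right_permsOn [AddCommMonoid β] {F : Finset α} {τ : Perm α} (hτ : τ ∈ permsOn F)
    (f : Perm α → β) : ∑ σ ∈ permsOn F, f (σ * τ) = ∑ σ ∈ permsOn F, f σ :=
  Finset.sum_nbij' (· * τ) (· * τ⁻¹) (fun _ h => mul_mem_permsOn h hτ)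
    (fun _ h => mul_mem_permsOn h (inv_mem_permsOn hτ)) (by simp) (by simp) (by simp)

/-- Every permutation of `insert x F` arises from exactly one permutation of `F`, by inserting `x`
as a fixed point or immediately before an element of `F` in its cycle. -/
lemma sum_permsOn_insert [AddCommMonoid β] {F : Finset α} {x : α} (hx : x ∉ F)
    (f : Perm α → β) :
    ∑ σ ∈ permsOn (insert x F), f σ =
      ∑ p ∈ permsOn F, (f p + ∑ a ∈ F, f (swap x a * p)) := by
  have h1 : ∀ p : Perm α, f p + ∑ a ∈ F, f (swap x a * p) =
      ∑ a ∈ insert x F, f (swap x a * p) := by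
    intro p
    rw [Finset.sum_insert hx, swap_self]
    rfl
  simp_rw [h1]
  rw [Finset.sum_sigma']
  refine Finset.sum_nbij' (fun σ => ⟨swap x (σ x) * σ, σ x⟩) (fun q => swap x q.2 * q.1)
    ?_ ?_ ?_ ?_ ?_
  · intro σ hσ
    have hσx : σ x ∈ insert x F := apply_mem_of_mem_permsOn hσ (Finset.mem_insert_self _ _)
    rw [Finset.mem_sigma]
    refine ⟨?_, hσx⟩
    have h2 : swap x (σ x) * σ ∈ permsOn (insert x F) :=
      mul_mem_permsOn (swap_mem_permsOn (Finset.mem_insert_self _ _) hσx) hσ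
    rw [mem_permsOn] at *
    intro y hy
    by_cases hyx : y = x
    · subst hyx
      simp
    · exact h2 y (by simp [hyx, hy])
  · rintro ⟨p, a⟩ h
    rw [Finset.mem_sigma] at h
    exact mul_mem_permsOn (swap_mem_permsOn (Finset.mem_insert_self _ _) h.2)
      (permsOn_mono (Finset.subset_insert _ _) h.1)
  · intro σ _
    simp [← mul_assoc]
  · rintro ⟨p, a⟩ h
    rw [Finset.mem_sigma] at h
    have : p x = x := mem_permsOn.1 h.1 x hx
    simp [← mul_assoc, this]
  · intro σ _
    simp [← mul_assoc]

lemma sum_permsOn_insert' [AddCommMonoid β] {F : Finset α} {x : α} (hx : x ∉ F)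
    (f : Perm α → β) :
    ∑ σ ∈ permsOn (insert x F), f σ =
      ∑ p ∈ permsOn F, (f p + ∑ a ∈ F, f (p * swap x a)) := by
  rw [← sum_inv_permsOn, sum_permsOn_insert hx, ← sum_inv_permsOn]
  simp

lemma sameCycle_of_forall_rel {σ : Perm α} {r : α → α → Prop} (hr : Equivalence r)
    (h : ∀ y, r y (σ y)) {y z : α} (hyz : σ.SameCycle y z) : r y z := by
  obtain ⟨n, rfl⟩ := hyz.exists_nat_pow_eq
  induction n with
  | zero => exact hr.refl _
  | succ n ih =>
    rw [pow_succ', Perm.mul_apply]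
    exact hr.trans (ih ⟨n, by simp⟩) (h _)

lemma swap_mul_apply_self {p : Perm α} {x a : α} (hp : p x = x) : (swap x a * p) x = a := by
  simp [hp]

/-- `swap x a * p` is `p` with `x` inserted just before `a`, which does not affect how the other
points are grouped into cycles. -/
lemma sameCycle_swap_mul {p : Perm α} {x a y z : α} (hp : p x = x) (hy : y ≠ x)
    (hz : z ≠ x) (hax : a ≠ x) : (swap x a * p).SameCycle y z ↔ p.SameCycle y z := by
  have hpx : ∀ w, w ≠ x → p w ≠ x := fun w hw h => hw (p.injective (h.trans hp.symm))
  constructor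
  · intro h
    -- Collapsing `x` onto `a` sends each step of the new permutation to a step of `p` or to no
    -- move.
    let π : α → α := fun w => if w = x then a else w
    have key : ∀ w, p.SameCycle (π w) (π ((swap x a * p) w)) := by
      intro w
      by_cases hw : w = x
      · subst hw
        rw [swap_mul_apply_self hp]
        simp [π, Perm.SameCycle.refl]
      · by_cases hwa : p w = a
        · have : (swap x a * p) w = x := by simp [hwa]
          rw [this]
          simp only [π, hw, if_false, if_true]
          exact ⟨1, by simpa using hwa⟩
        · have : (swap x a * p) w = p w := by
            rw [Perm.mul_apply, swap_apply_of_ne_of_ne (hpx w hw) hwa]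
          rw [this]
          simp only [π, hw, hpx w hw, if_false]
          exact ⟨1, by simp⟩
    have := sameCycle_of_forall_rel (r := fun y z => p.SameCycle (π y) (π z))
      ⟨fun _ => .refl _ _, fun h => h.symm, fun h h' => h.trans h'⟩ key h
    simpa [π, hy, hz] using this
  · intro h
    -- Conversely a step of `p` is one step of the new permutation, or two when it passes through
    -- `x`.
    have key : ∀ w, w ≠ x → (swap x a * p).SameCycle w (p w) := by
      intro w hw
      by_cases hwa : p w = a
      · have : (swap x a * p) w = x := by simp [hwa]
        refine ⟨2, ?_⟩
        rw [zpow_ofNat, pow_two, Perm.mul_apply, this, swap_mul_apply_self hp, hwa]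
      · refine ⟨1, ?_⟩
        rw [zpow_one, Perm.mul_apply, swap_apply_of_ne_of_ne (hpx w hw) hwa]
    have := sameCycle_of_forall_rel
      (r := fun y z => y = z ∨ (y ≠ x ∧ z ≠ x ∧ (swap x a * p).SameCycle y z))
      ⟨fun _ => .inl rfl, ?_, ?_⟩ (fun w => ?_) h
    · rcases this with rfl | h
      · exact .refl _ _
      · exact h.2.2
    · rintro y z (rfl | ⟨h1, h2, h3⟩)
      · exact .inl rfl
      · exact .inr ⟨h2, h1, h3.symm⟩
    · rintro y z w (rfl | ⟨h1, h2, h3⟩) (rfl | ⟨h4, h5, h6⟩)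
      · exact .inl rfl
      · exact .inr ⟨h4, h5, h6⟩
      · exact .inr ⟨h1, h2, h3⟩
      · exact .inr ⟨h1, h5, h3.trans h6⟩
    · by_cases hw : w = x
      · subst hw
        exact .inl hp.symm
      · exact .inr ⟨hw, hpx w hw, key w hw⟩

lemma sameCycle_swap_mul_self {p : Perm α} {x a : α} (hp : p x = x) :
    (swap x a * p).SameCycle x a :=
  ⟨1, by rw [zpow_one, swap_mul_apply_self hp]⟩

lemma mul_swap_of_apply_eq_self {p : Perm α} {x : α} (hp : p x = x) (a : α) :
    p * swap x a = swap x (p a) * p := by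
  rw [mul_swap_eq_swap_mul, hp]

/-- `σ` moves the elements of `F` in a single cycle. -/
def TransOn (F : Finset α) (σ : Perm α) : Prop := ∀ x ∈ F, ∀ y ∈ F, σ.SameCycle x y

lemma transOn_swap_mul {F : Finset α} {x a : α} {p : Perm α} (hx : x ∉ F)
    (hp : p ∈ permsOn F) (ha : a ∈ F) :
    TransOn (insert x F) (swap x a * p) ↔ TransOn F p := by
  have hpx := mem_permsOn.1 hp x hx
  have hne : ∀ y ∈ F, y ≠ x := fun y hy h => hx (h ▸ hy)
  have hself := sameCycle_swap_mul_self (a := a) hpx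
  constructor
  · intro h y hy z hz
    exact (sameCycle_swap_mul hpx (hne y hy) (hne z hz) (hne a ha)).1
      (h y (Finset.mem_insert_of_mem hy) z (Finset.mem_insert_of_mem hz))
  · intro h
    have key : ∀ y ∈ insert x F, (swap x a * p).SameCycle y a := by
      intro y hy
      rcases Finset.mem_insert.1 hy with rfl | hy
      · exact hself
      · exact (sameCycle_swap_mul hpx (hne y hy) (hne a ha) (hne a ha)).2 (h y hy a ha)
    exact fun y hy z hz => (key y hy).trans (key z hz).symm

lemma transOn_mul_swap {F : Finset α} {x a : α} {p : Perm α} (hx : x ∉ F)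
    (hp : p ∈ permsOn F) (ha : a ∈ F) :
    TransOn (insert x F) (p * swap x a) ↔ TransOn F p := by
  rw [mul_swap_of_apply_eq_self (mem_permsOn.1 hp x hx)]
  exact transOn_swap_mul hx hp (apply_mem_of_mem_permsOn hp ha)

lemma not_transOn_insert {F : Finset α} {x : α} {p : Perm α} (hx : x ∉ F)
    (hp : p ∈ permsOn F) (hF : F.Nonempty) : ¬ TransOn (insert x F) p := by
  obtain ⟨y, hy⟩ := hF
  intro h
  have h1 := h x (Finset.mem_insert_self _ _) y (Finset.mem_insert_of_mem hy)
  have h2 := h1.eq_of_left (mem_permsOn.1 hp x hx)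
  exact hx (h2 ▸ hy)

open scoped Classical in
/-- The permutations that fix the complement of `F` and form a single cycle on `F`. -/
noncomputable def cyclesOn (F : Finset α) : Finset (Perm α) := (permsOn F).filter (TransOn F)

/-- A fixed point `x` rules out a single cycle, whereas inserting `x` before any `a` neither creates
nor destroys one. -/
lemma sum_cyclesOn_insert [AddCommMonoid β] {F : Finset α} {x : α} (hx : x ∉ F)
    (hF : F.Nonempty) (f : Perm α → β) :
    ∑ σ ∈ cyclesOn (insert x F), f σ = ∑ p ∈ cyclesOn F, ∑ a ∈ F, f (swap x a * p) := by
  classical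
  rw [cyclesOn, cyclesOn, Finset.sum_filter, Finset.sum_filter, sum_permsOn_insert hx]
  refine Finset.sum_congr rfl fun p hp => ?_
  rw [if_neg (not_transOn_insert hx hp hF), zero_add,
    Finset.sum_congr rfl fun a ha => by
      rw [show (if TransOn (insert x F) (swap x a * p) then f (swap x a * p) else 0) =
        if TransOn F p then f (swap x a * p) else 0 by simp only [transOn_swap_mul hx hp ha]]]
  split_ifs <;> simp

lemma card_cyclesOn_insert (b : α) (F : Finset α) (hb : b ∉ F) :
    (cyclesOn (insert b F)).card = F.card.factorial := by
  classical
  induction F using Finset.induction_on with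
  | empty =>
    have : cyclesOn ({b} : Finset α) = {1} := by
      rw [cyclesOn, permsOn_singleton, Finset.filter_singleton, if_pos]
      intro x hx y hy
      rw [Finset.mem_singleton.1 hx, Finset.mem_singleton.1 hy]
    simpa using congrArg Finset.card this
  | insert x F hx ih =>
    have hbx : b ≠ x := fun h => hb (h ▸ Finset.mem_insert_self _ _)
    have hbF : b ∉ F := fun h => hb (Finset.mem_insert_of_mem h)
    have hxF : x ∉ insert b F := by simp [hx, hbx.symm]
    rw [Finset.insert_comm, Finset.card_eq_sum_ones,
      sum_cyclesOn_insert hxF (Finset.insert_nonempty _ _)]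
    simp [ih hbF, hbF, hx, Nat.factorial_succ, mul_comm]

end PermsOn

/-! ### Hook symmetrizers and the expansion of the class sum of cycles. -/

section HookExpansion

variable {α : Type*} [Fintype α] [DecidableEq α]

/-- The sum of `sign c * φ (c * ρ)` over the permutations `c` of `insert b A` and `ρ` of
`insert b B`: for disjoint `A`, `B` this pairs `φ` with a Young symmetrizer of hook shape. -/
def hookSum (b : α) (A B : Finset α) (φ : Perm α → ℤ) : ℤ :=
  ∑ c ∈ permsOn (insert b A), ∑ ρ ∈ permsOn (insert b B), (Perm.sign c : ℤ) * φ (c * ρ)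

lemma sign_swap_mul {x a : α} (h : x ≠ a) (c : Perm α) :
    ((Perm.sign (swap x a * c) : ℤˣ) : ℤ) = -(Perm.sign c : ℤ) := by
  rw [Perm.sign_mul, Perm.sign_swap h]
  simp

/-- Prescribing `c b = y` makes the induction close: the restricted sum does not depend on `y`, and
summing over `y` yields the factor `F.card + 1` of `sum_hookSum`. -/
lemma sum_cyclesOn_eq_aux (b : α) (F : Finset α) (hb : b ∉ F) :
    ∀ y ∈ insert b F, ∀ φ : Perm α → ℤ,
      ∑ A ∈ F.powerset, (-1 : ℤ) ^ A.card * ∑ c ∈ permsOn (insert b A),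
        ∑ ρ ∈ permsOn (insert b (F \ A)), (if c b = y then (Perm.sign c : ℤ) * φ (c * ρ) else 0) =
      ∑ σ ∈ cyclesOn (insert b F), φ σ := by
  classical
  induction F using Finset.induction_on with
  | empty =>
    intro y hy φ
    have : cyclesOn ({b} : Finset α) = {1} := by
      rw [cyclesOn, permsOn_singleton, Finset.filter_singleton, if_pos]
      intro x hx y hy
      rw [Finset.mem_singleton.1 hx, Finset.mem_singleton.1 hy]
    have hy : b = y := by simpa [eq_comm] using hy
    subst hy
    simp [this, permsOn_singleton]
  | insert x F hx ih =>
    have hbx : b ≠ x := fun h => hb (h ▸ Finset.mem_insert_self _ _)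
    have hbF : b ∉ F := fun h => hb (Finset.mem_insert_of_mem h)
    have hxF : x ∉ insert b F := by simp [hx, hbx.symm]
    specialize ih hbF
    intro y hy φ
    have hR : ∀ A ∈ F.powerset, insert b (insert x F \ A) = insert x (insert b (F \ A)) := by
      intro A hA
      rw [Finset.insert_sdiff_of_notMem _ (fun h => hx (Finset.mem_powerset.1 hA h)),
        Finset.insert_comm]
    have hC : ∀ A ∈ F.powerset, insert x F \ insert x A = F \ A := by
      intro A hA
      ext z
      simp only [Finset.mem_sdiff, Finset.mem_insert]
      constructor
      · rintro ⟨h1 | h1, h2⟩ <;> tauto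
      · rintro ⟨h1, h2⟩
        exact ⟨.inr h1, by rintro (rfl | h3) <;> tauto⟩
    rw [Finset.insert_comm b x F, sum_cyclesOn_insert hxF (Finset.insert_nonempty _ _),
      Finset.sum_powerset_insert hx, ← Finset.sum_add_distrib]
    -- Pair the set `A` with `insert x A`. The terms where `x` is a fixed point cancel; those where
    -- `x` is inserted into `ρ` or into `c` survive with the same sign, since the swap in `c`
    -- offsets the extra -1.
    have step : ∀ A ∈ F.powerset,
        (-1 : ℤ) ^ A.card * ∑ c ∈ permsOn (insert b A),
          ∑ ρ ∈ permsOn (insert b (insert x F \ A)),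
            (if c b = y then (Perm.sign c : ℤ) * φ (c * ρ) else 0) +
        (-1 : ℤ) ^ (insert x A).card * ∑ c ∈ permsOn (insert b (insert x A)),
          ∑ ρ ∈ permsOn (insert b (insert x F \ insert x A)),
            (if c b = y then (Perm.sign c : ℤ) * φ (c * ρ) else 0) =
        (-1 : ℤ) ^ A.card * ∑ c ∈ permsOn (insert b A), ∑ ρ ∈ permsOn (insert b (F \ A)),
          (Perm.sign c : ℤ) *
            ((if c b = y then ∑ a ∈ insert b (F \ A), φ (swap x (c (ρ a)) * (c * ρ)) else 0) +
              ∑ a ∈ insert b A, if swap x a (c b) = y then φ (swap x a * (c * ρ)) else 0) := by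
      intro A hA
      have hAF := Finset.mem_powerset.1 hA
      have hxA : x ∉ insert b A := fun h => hxF (Finset.insert_subset_insert _ hAF h)
      have hxR : x ∉ insert b (F \ A) :=
        fun h => hxF (Finset.insert_subset_insert _ Finset.sdiff_subset h)
      rw [hR A hA, hC A hA, Finset.card_insert_of_notMem (fun h => hx (hAF h)),
        Finset.insert_comm b x A, sum_permsOn_insert hxA, pow_succ, mul_neg_one, neg_mul,
        ← sub_eq_add_neg, ← mul_sub, ← Finset.sum_sub_distrib]
      congr 1
      refine Finset.sum_congr rfl fun c hc => ?_
      rw [sum_permsOn_insert' hxR, Finset.sum_comm, ← Finset.sum_add_distrib,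
        ← Finset.sum_sub_distrib]
      refine Finset.sum_congr rfl fun ρ hρ => ?_
      have hcx := mem_permsOn.1 hc x hxA
      have hρx := mem_permsOn.1 hρ x hxR
      have e1 : ∀ a, c * (ρ * swap x a) = swap x (c (ρ a)) * (c * ρ) := by
        intro a
        rw [← mul_assoc, mul_swap_of_apply_eq_self (p := c * ρ) (by simp [hcx, hρx])]
        rfl
      have e2 : ∀ a ∈ insert b A, (if (swap x a * c) b = y then
          ((Perm.sign (swap x a * c) : ℤˣ) : ℤ) * φ (swap x a * c * ρ) else 0) =
          -((Perm.sign c : ℤ) *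
            if swap x a (c b) = y then φ (swap x a * (c * ρ)) else 0) := by
        intro a ha
        rw [sign_swap_mul (ne_of_mem_of_not_mem ha hxA).symm, mul_assoc, Perm.mul_apply]
        split_ifs <;> simp
      rw [Finset.sum_congr rfl e2, Finset.sum_neg_distrib, ← Finset.mul_sum]
      simp_rw [e1]
      split_ifs with h
      · rw [← Finset.mul_sum]
        ring
      · simp
    rw [Finset.sum_congr rfl step]
    clear step
    by_cases hyx : y = x
    -- If `y` is the new point, only its insertion before `c b` counts; summing the induction
    -- hypothesis over all values of `c b` recovers all insertions.
    · subst hyx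
      rw [Finset.sum_comm (s := cyclesOn _),
        ← Finset.sum_congr rfl fun z hz => ih z hz fun p => φ (swap y z * p),
        Finset.sum_comm (s := insert b F)]
      refine Finset.sum_congr rfl fun A hA => ?_
      have hAF := Finset.mem_powerset.1 hA
      rw [← Finset.mul_sum, Finset.sum_comm (s := insert b F)]
      congr 1
      refine Finset.sum_congr rfl fun c hc => ?_
      rw [Finset.sum_comm (s := insert b F)]
      refine Finset.sum_congr rfl fun ρ hρ => ?_
      have hcb : c b ∈ insert b A := apply_mem_of_mem_permsOn hc (Finset.mem_insert_self _ _)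
      have hcbF : c b ∈ insert b F := Finset.insert_subset_insert _ hAF hcb
      have hcby : c b ≠ y := fun h => hxF (h ▸ hcbF)
      rw [if_neg hcby, zero_add, Finset.sum_ite_eq, if_pos hcbF,
        Finset.sum_eq_single_of_mem _ hcb, if_pos (by simp)]
      intro a ha hne
      rw [if_neg]
      rw [swap_apply_of_ne_of_ne hcby (Ne.symm hne)]
      exact hcby
    · have hyF : y ∈ insert b F := by
        rw [Finset.insert_comm] at hy
        exact (Finset.mem_insert.1 hy).resolve_left hyx
      rw [← ih y hyF fun p => ∑ a ∈ insert b F, φ (swap x a * p)]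
      refine Finset.sum_congr rfl fun A hA => ?_
      have hAF := Finset.mem_powerset.1 hA
      congr 1
      refine Finset.sum_congr rfl fun c hc => Finset.sum_congr rfl fun ρ hρ => ?_
      have hcb : c b ∈ insert b A := apply_mem_of_mem_permsOn hc (Finset.mem_insert_self _ _)
      have hcbF : c b ∈ insert b F := Finset.insert_subset_insert _ hAF hcb
      have hcbx : c b ≠ x := fun h => hxF (h ▸ hcbF)
      -- When `c b = y`, insertions into `ρ` account for the places `y` and `F \ A`, those into `c`
      -- for `insert b A` without `y`: together each place of `insert b F` once.
      by_cases h : c b = y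
      · have e1 : ∑ a ∈ insert b (F \ A), φ (swap x (c (ρ a)) * (c * ρ)) =
            φ (swap x y * (c * ρ)) + ∑ a ∈ F \ A, φ (swap x a * (c * ρ)) := by
          rw [sum_comp_permsOn hρ fun a => φ (swap x (c a) * (c * ρ)),
            Finset.sum_insert (by simp [hbF]), h]
          congr 1
          refine Finset.sum_congr rfl fun a ha => ?_
          rw [mem_permsOn.1 hc a]
          rw [Finset.mem_sdiff] at ha
          simp only [Finset.mem_insert, not_or]
          exact ⟨fun h => hbF (h ▸ ha.1), ha.2⟩
        have e2 : ∑ a ∈ insert b A, (if swap x a (c b) = y then φ (swap x a * (c * ρ)) else 0) =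
            ∑ a ∈ (insert b A).erase y, φ (swap x a * (c * ρ)) := by
          rw [← Finset.add_sum_erase _ _ (h ▸ hcb), if_neg, zero_add]
          · refine Finset.sum_congr rfl fun a ha => ?_
            rw [if_pos]
            rw [h, swap_apply_of_ne_of_ne hyx (Finset.ne_of_mem_erase ha).symm]
          · rw [h, swap_apply_right]
            exact Ne.symm hyx
        have e3 : ∑ a ∈ insert b F, φ (swap x a * (c * ρ)) =
            ∑ a ∈ insert b A, φ (swap x a * (c * ρ)) + ∑ a ∈ F \ A, φ (swap x a * (c * ρ)) := by
          rw [← Finset.sum_union]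
          · congr 1
            rw [Finset.insert_union, Finset.union_sdiff_of_subset hAF]
          · rw [Finset.disjoint_left]
            intro a ha ha'
            rw [Finset.mem_sdiff] at ha'
            rcases Finset.mem_insert.1 ha with rfl | ha
            · exact hbF ha'.1
            · exact ha'.2 ha
        rw [if_pos h, if_pos h, e1, e2, e3, ← Finset.add_sum_erase (insert b A) _ (h ▸ hcb)]
        ring
      · rw [if_neg h, if_neg h, zero_add, Finset.sum_eq_zero, mul_zero]
        intro a ha
        rw [if_neg]
        by_cases hca : c b = a
        · rw [← hca, swap_apply_right]
          exact Ne.symm hyx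
        · rw [swap_apply_of_ne_of_ne hcbx hca]
          exact h

/-- The class sum of the maximal cycles as a combination of hook symmetrizers. -/
lemma sum_hookSum (b : α) (F : Finset α) (hb : b ∉ F) (φ : Perm α → ℤ) :
    ∑ A ∈ F.powerset, (-1 : ℤ) ^ A.card * hookSum b A (F \ A) φ =
      (F.card + 1) * ∑ σ ∈ cyclesOn (insert b F), φ σ := by
  have h := Finset.sum_congr rfl fun y hy => sum_cyclesOn_eq_aux b F hb y hy φ
  rw [Finset.sum_const, Finset.card_insert_of_notMem hb, nsmul_eq_mul, Nat.cast_add,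
    Nat.cast_one] at h
  rw [← h, Finset.sum_comm]
  refine Finset.sum_congr rfl fun A hA => ?_
  rw [← Finset.mul_sum, Finset.sum_comm, hookSum]
  congr 1
  refine Finset.sum_congr rfl fun c hc => ?_
  rw [Finset.sum_comm]
  refine Finset.sum_congr rfl fun ρ hρ => ?_
  rw [Finset.sum_ite_eq, if_pos]
  exact Finset.insert_subset_insert _ (Finset.mem_powerset.1 hA)
    (apply_mem_of_mem_permsOn hc (Finset.mem_insert_self _ _))

/-- The new elements of the larger symmetric group are `swap x a * c`, of opposite sign; moving the
swap into the test function gives a one-point recursion. -/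
lemma hookSum_insert_left {b x : α} {A B : Finset α} (hx : x ∉ insert b A) (φ : Perm α → ℤ) :
    hookSum b (insert x A) B φ =
      hookSum b A B fun p => φ p - ∑ a ∈ insert b A, φ (swap x a * p) := by
  rw [hookSum, hookSum, Finset.insert_comm, sum_permsOn_insert hx]
  refine Finset.sum_congr rfl fun c _ => ?_
  rw [Finset.sum_comm, ← Finset.sum_add_distrib]
  refine Finset.sum_congr rfl fun ρ _ => ?_
  rw [mul_sub, Finset.mul_sum, sub_eq_add_neg, ← Finset.sum_neg_distrib]
  congr 1
  refine Finset.sum_congr rfl fun a ha => ?_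
  rw [sign_swap_mul (ne_of_mem_of_not_mem ha hx).symm, mul_assoc, neg_mul]

lemma hookSum_insert_right {b x : α} {A B : Finset α} (hx : x ∉ insert b B) (φ : Perm α → ℤ) :
    hookSum b A (insert x B) φ =
      hookSum b A B fun p => φ p + ∑ a ∈ insert b B, φ (p * swap x a) := by
  rw [hookSum, hookSum, Finset.insert_comm]
  refine Finset.sum_congr rfl fun c _ => ?_
  rw [sum_permsOn_insert' hx]
  refine Finset.sum_congr rfl fun ρ _ => ?_
  simp_rw [mul_add, Finset.mul_sum, mul_assoc]

lemma hookSum_congr {b : α} {A B : Finset α} {φ ψ : Perm α → ℤ}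
    (h : ∀ p ∈ permsOn (insert b (A ∪ B)), φ p = ψ p) : hookSum b A B φ = hookSum b A B ψ := by
  refine Finset.sum_congr rfl fun c hc => Finset.sum_congr rfl fun ρ hρ => ?_
  rw [h]
  exact mul_mem_permsOn
    (permsOn_mono (Finset.insert_subset_insert _ Finset.subset_union_left) hc)
    (permsOn_mono (Finset.insert_subset_insert _ Finset.subset_union_right) hρ)

lemma hookSum_const_mul {b : α} {A B : Finset α} (k : ℤ) (φ : Perm α → ℤ) :
    (hookSum b A B fun p => k * φ p) = k * hookSum b A B φ := by
  simp_rw [hookSum, Finset.mul_sum]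
  exact Finset.sum_congr rfl fun c _ => Finset.sum_congr rfl fun ρ _ => by ring

lemma hookSum_empty (b : α) (φ : Perm α → ℤ) : hookSum b ∅ ∅ φ = φ 1 := by
  simp [hookSum, permsOn_singleton]

-- Adding `x` to `A` leaves `A.card + 1` places for it, each preserving the single cycle and
-- reversing the sign.
open scoped Classical in
lemma hookSum_transOn_left (b : α) (A : Finset α) (hb : b ∉ A) :
    hookSum b A ∅ (fun p => if TransOn (insert b A) p then 1 else 0) =
      (-1) ^ A.card * A.card.factorial := by
  induction A using Finset.induction_on with
  | empty =>
    rw [hookSum_empty, if_pos]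
    · simp
    · intro x hx y hy
      rw [Finset.mem_insert, or_iff_left (Finset.notMem_empty _)] at hx hy
      rw [hx, hy]
  | insert x A hx ih =>
    have hbx : b ≠ x := fun h => hb (h ▸ Finset.mem_insert_self _ _)
    have hbA : b ∉ A := fun h => hb (Finset.mem_insert_of_mem h)
    have hxA : x ∉ insert b A := by simp [hx, hbx.symm]
    have h1 : ∀ p ∈ permsOn (insert b (A ∪ ∅)),
        (if TransOn (insert b (insert x A)) p then (1 : ℤ) else 0) -
          ∑ a ∈ insert b A, (if TransOn (insert b (insert x A)) (swap x a * p) then (1 : ℤ) else 0)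
        = -(A.card + 1) * if TransOn (insert b A) p then 1 else 0 := by
      intro p hp
      rw [Finset.union_empty] at hp
      rw [Finset.insert_comm, if_neg (not_transOn_insert hxA hp (Finset.insert_nonempty _ _)),
        Finset.sum_congr rfl fun a ha => if_congr (transOn_swap_mul hxA hp ha) rfl rfl,
        Finset.sum_const, Finset.card_insert_of_notMem hbA, nsmul_eq_mul]
      push_cast
      ring
    rw [hookSum_insert_left hxA, hookSum_congr h1, hookSum_const_mul, ih hbA,
      Finset.card_insert_of_notMem hx, Nat.factorial_succ]
    push_cast
    ring

open scoped Classical in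
lemma hookSum_transOn (b : α) (A B : Finset α) (hA : b ∉ A) (hB : b ∉ B) (hAB : Disjoint A B) :
    hookSum b A B (fun p => if TransOn (insert b (A ∪ B)) p then 1 else 0) =
      (-1) ^ A.card * A.card.factorial * B.card.factorial := by
  induction B using Finset.induction_on with
  | empty =>
    rw [Finset.union_empty, hookSum_transOn_left b A hA]
    simp
  | insert x B hx ih =>
    rw [Finset.disjoint_insert_right] at hAB
    have hbx : b ≠ x := fun h => hB (h ▸ Finset.mem_insert_self _ _)
    have hbB : b ∉ B := fun h => hB (Finset.mem_insert_of_mem h)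
    have hxB : x ∉ insert b B := by simp [hx, hbx.symm]
    have hxF : x ∉ insert b (A ∪ B) := by simp [hx, hbx.symm, hAB.1]
    have h1 : ∀ p ∈ permsOn (insert b (A ∪ B)),
        (if TransOn (insert b (A ∪ insert x B)) p then (1 : ℤ) else 0) +
          ∑ a ∈ insert b B,
            (if TransOn (insert b (A ∪ insert x B)) (p * swap x a) then (1 : ℤ) else 0)
        = (B.card + 1) * if TransOn (insert b (A ∪ B)) p then 1 else 0 := by
      intro p hp
      rw [Finset.union_insert, Finset.insert_comm,
        if_neg (not_transOn_insert hxF hp (Finset.insert_nonempty _ _)),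
        Finset.sum_congr rfl fun a ha => if_congr (transOn_mul_swap hxF hp
          (Finset.insert_subset_insert _ Finset.subset_union_right ha)) rfl rfl,
        Finset.sum_const, Finset.card_insert_of_notMem hbB, nsmul_eq_mul]
      push_cast
      ring
    rw [hookSum_insert_right hxB, hookSum_congr h1, hookSum_const_mul, ih hbB hAB.2,
      Finset.card_insert_of_notMem hx, Nat.factorial_succ]
    push_cast
    ring

end HookExpansion

/-! ### The class sum acts on hook symmetrizers by scalars. -/

section ClassSum

variable {α : Type*} [Fintype α] [DecidableEq α]

/-- By counting, some `d` in `insert b A` has its preimage outside `A`, and by hypothesis only one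
does. After swapping `d` with `b`, the permutation preserves `Aᶜ`; its restriction there is `ρ`. -/
lemma exists_mul_eq_of_card_le_one {b : α} {A : Finset α} {p : Perm α}
    (h : ∀ x ∈ insert b A, ∀ y ∈ insert b A, p⁻¹ x ∉ A → p⁻¹ y ∉ A → x = y) (hb : b ∉ A) :
    ∃ c ∈ permsOn (insert b A), ∃ ρ ∈ permsOn Aᶜ, c * ρ = p := by
  obtain ⟨d, hd, hdA⟩ : ∃ d ∈ insert b A, p⁻¹ d ∉ A := by
    by_contra! hcon
    have := Finset.card_le_card_of_injOn (⇑p⁻¹) hcon (p⁻¹).injective.injOn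
    rw [Finset.card_insert_of_notMem hb] at this
    omega
  set q : Perm α := swap b d * p with hq
  have hqR : ∀ y, y ∈ Aᶜ → q y ∈ Aᶜ := by
    intro y hy
    rw [Finset.mem_compl] at *
    by_cases hpy : p y ∈ insert b A
    · have : p y = d := h _ hpy d hd (by simpa using hy) hdA
      rw [hq, Perm.mul_apply, this, swap_apply_right]
      exact hb
    · have hbd : p y ≠ b ∧ p y ∉ A := by simpa using hpy
      rw [hq, Perm.mul_apply, swap_apply_of_ne_of_ne hbd.1 (fun h' => hpy (h' ▸ hd))]
      exact hbd.2
  set ρ : Perm α := Perm.ofSubtype (Perm.subtypePermOfFintype q hqR) with hρ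
  have hρR : ∀ y ∈ Aᶜ, ρ y = q y := by
    intro y hy
    rw [hρ, Perm.ofSubtype_apply_of_mem _ hy]
    rfl
  have hρmem : ρ ∈ permsOn Aᶜ := by
    rw [mem_permsOn]
    intro y hy
    rw [hρ, Perm.ofSubtype_apply_of_not_mem _ hy]
  refine ⟨p * ρ⁻¹, ?_, ρ, hρmem, by simp⟩
  rw [mem_permsOn]
  intro x hx
  have hxb : x ≠ b ∧ x ∉ A := by simpa using hx
  have hxR : ρ⁻¹ x ∈ Aᶜ :=
    apply_mem_of_mem_permsOn (inv_mem_permsOn hρmem) (Finset.mem_compl.2 hxb.2)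
  have h1 : q (ρ⁻¹ x) = x := by rw [← hρR _ hxR, (show ρ (ρ⁻¹ x) = x from ρ.apply_symm_apply x)]
  have h2 : p (ρ⁻¹ x) = swap b d x := by
    rw [← swap_apply_self b d (p (ρ⁻¹ x))]
    exact congrArg _ h1
  rw [Perm.mul_apply, h2, swap_apply_of_ne_of_ne hxb.1 (fun h' => hx (h' ▸ hd))]

/-- Two factorizations differ by an element supported both in `insert b A` and in `Aᶜ`, hence in
`{b}`. -/
lemma mul_injOn_permsOn (b : α) (A : Finset α) :
    Set.InjOn (fun q : Perm α × Perm α => q.1 * q.2)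
      (permsOn (insert b A) ×ˢ permsOn Aᶜ : Finset (Perm α × Perm α)) := by
  rintro ⟨c, ρ⟩ h1 ⟨c', ρ'⟩ h2 heq
  simp only [Finset.mem_coe, Finset.mem_product] at h1 h2 heq
  have e : c'⁻¹ * c = ρ' * ρ⁻¹ := by
    rw [inv_mul_eq_iff_eq_mul, ← mul_assoc, ← heq, mul_inv_cancel_right]
  have hmem : c'⁻¹ * c ∈ permsOn ({b} : Finset α) := by
    rw [mem_permsOn]
    intro x hx
    by_cases hxA : x ∈ A
    · rw [e]
      exact mem_permsOn.1 (mul_mem_permsOn h2.2 (inv_mem_permsOn h1.2)) x (by simpa using hxA)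
    · refine mem_permsOn.1 (mul_mem_permsOn (inv_mem_permsOn h2.1) h1.1) x ?_
      rw [Finset.mem_insert]
      rw [Finset.mem_singleton] at hx
      tauto
  rw [permsOn_singleton, Finset.mem_singleton] at hmem
  have hc : c = c' := (inv_mul_eq_one.1 hmem).symm
  subst hc
  simpa using heq

lemma transOn_univ_conj (c p : Perm α) :
    TransOn Finset.univ (c * p * c⁻¹) ↔ TransOn Finset.univ p := by
  constructor
  · intro h x _ y _
    have := h (c x) (Finset.mem_univ _) (c y) (Finset.mem_univ _)
    rw [Perm.sameCycle_conj] at this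
    simpa using this
  · intro h x _ y _
    rw [Perm.sameCycle_conj]
    exact h _ (Finset.mem_univ _) _ (Finset.mem_univ _)

lemma mem_cyclesOn_univ {p : Perm α} : p ∈ cyclesOn Finset.univ ↔ TransOn Finset.univ p := by
  classical
  rw [cyclesOn, Finset.mem_filter, and_iff_right]
  rw [mem_permsOn]
  simp

lemma sum_cyclesOn_univ_conj {β : Type*} [AddCommMonoid β] (c : Perm α) (f : Perm α → β) :
    ∑ p ∈ cyclesOn Finset.univ, f (c * p * c⁻¹) = ∑ p ∈ cyclesOn Finset.univ, f p := by
  refine Finset.sum_nbij' (fun p => c * p * c⁻¹) (fun p => c⁻¹ * p * c) ?_ ?_ ?_ ?_ ?_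
  · intro p hp
    rw [mem_cyclesOn_univ] at *
    exact (transOn_univ_conj c p).2 hp
  · intro p hp
    rw [mem_cyclesOn_univ] at *
    simpa using (transOn_univ_conj c⁻¹ p).2 hp
  all_goals simp [mul_assoc]

/-- The class sum of the maximal cycles acts on a hook symmetrizer as a scalar. -/
lemma sum_cyclesOn_hookSum {b : α} {A B : Finset α} (hA : b ∉ A) (hB : b ∉ B)
    (hAB : Disjoint A B) (hU : insert b (A ∪ B) = Finset.univ) (φ : Perm α → ℤ) :
    ∑ p ∈ cyclesOn Finset.univ, hookSum b A B (fun σ => φ (p * σ)) =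
      (-1) ^ A.card * A.card.factorial * B.card.factorial * hookSum b A B φ := by
  classical
  have hR : insert b B = Aᶜ := by
    ext z
    have hz := Finset.mem_univ z
    rw [← hU] at hz
    have := fun h : z ∈ A => Finset.disjoint_left.1 hAB h
    simp only [Finset.mem_insert, Finset.mem_union, Finset.mem_compl] at *
    constructor
    · rintro (rfl | h) <;> tauto
    · tauto
  -- `X` is alternating under the left factor group and invariant under the right one, so on
  -- products `c * ρ` it is determined by `X 1`.
  set X : Perm α → ℤ := fun p => ∑ c ∈ permsOn (insert b A), ∑ ρ ∈ permsOn (insert b B),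
    (Perm.sign c : ℤ) * φ (c * p * ρ) with hX
  have hXl : ∀ c0 ∈ permsOn (insert b A), ∀ p, X (c0 * p) = (Perm.sign c0 : ℤ) * X p := by
    intro c0 hc0 p
    simp only [hX]
    rw [← sum_mul_right_permsOn hc0 fun c => ∑ ρ ∈ permsOn (insert b B),
      (Perm.sign c : ℤ) * φ (c * p * ρ), Finset.mul_sum]
    refine Finset.sum_congr rfl fun c _ => ?_
    rw [Finset.mul_sum]
    refine Finset.sum_congr rfl fun ρ _ => ?_
    rw [Perm.sign_mul, Units.val_mul, ← mul_assoc c c0 p, ← mul_assoc, ← mul_assoc,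
      mul_comm _ (Perm.sign c : ℤ), mul_assoc (Perm.sign c : ℤ), ← Units.val_mul,
      Int.units_mul_self, Units.val_one, mul_one]
  have hXr : ∀ ρ0 ∈ permsOn (insert b B), ∀ p, X (p * ρ0) = X p := by
    intro ρ0 hρ0 p
    simp only [hX]
    refine Finset.sum_congr rfl fun c _ => ?_
    rw [← sum_mul_left_permsOn hρ0 fun ρ => (Perm.sign c : ℤ) * φ (c * p * ρ)]
    simp only [mul_assoc]
  -- The classical symmetrizer argument: a transposition in the left group that equals, across `p`,
  -- one in the right group forces `X p = -X p`.
  have hX0 : ∀ p, (∃ x ∈ insert b A, ∃ y ∈ insert b A, p⁻¹ x ∉ A ∧ p⁻¹ y ∉ A ∧ x ≠ y) →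
      X p = 0 := by
    rintro p ⟨x, hx, y, hy, hpx, hpy, hxy⟩
    have h1 := hXl _ (swap_mem_permsOn hx hy) p
    have h2 : swap x y * p = p * swap (p⁻¹ x) (p⁻¹ y) := by
      rw [mul_swap_eq_swap_mul]
      simp
    have h3 := hXr (swap (p⁻¹ x) (p⁻¹ y)) (swap_mem_permsOn (by rw [hR]; simpa using hpx)
      (by rw [hR]; simpa using hpy)) p
    rw [h2, h3, Perm.sign_swap hxy] at h1
    simp at h1
    omega
  -- Conjugation invariance of the cycles turns `p * c * ρ` into `c * p * ρ`.
  have step1 : ∑ p ∈ cyclesOn Finset.univ, hookSum b A B (fun σ => φ (p * σ)) =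
      ∑ p ∈ cyclesOn Finset.univ, X p := by
    simp only [hX, hookSum]
    rw [Finset.sum_comm, Finset.sum_comm (s := cyclesOn _)]
    refine Finset.sum_congr rfl fun c _ => ?_
    rw [Finset.sum_comm, Finset.sum_comm (s := cyclesOn _)]
    refine Finset.sum_congr rfl fun ρ _ => ?_
    rw [← Finset.mul_sum, ← Finset.mul_sum, ← sum_cyclesOn_univ_conj c]
    simp only [mul_assoc, inv_mul_cancel_left]
  have step2 : ∑ p ∈ cyclesOn Finset.univ, X p =
      ∑ p, if TransOn Finset.univ p then X p else 0 := by
    rw [← Finset.sum_filter]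
    congr 1
    ext p
    simp [mem_cyclesOn_univ]
  -- Only uniquely factorizable permutations contribute, so the sum over cycles is a sum over pairs,
  -- i.e. a `hookSum` of the single-cycle indicator.
  have step3 : ∑ q ∈ permsOn (insert b A) ×ˢ permsOn Aᶜ,
      (if TransOn Finset.univ (q.1 * q.2) then X (q.1 * q.2) else 0) =
      ∑ p, if TransOn Finset.univ p then X p else 0 := by
    refine Finset.sum_of_injOn (fun q : Perm α × Perm α => q.1 * q.2) (mul_injOn_permsOn b A)
      (fun _ _ => Finset.mem_coe.2 (Finset.mem_univ _)) ?_ (fun _ _ => rfl)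
    intro p _ hp
    rw [hX0 p, ite_self]
    by_contra! hcon
    obtain ⟨c, hc, ρ, hρ, h⟩ := exists_mul_eq_of_card_le_one
      (fun x hx y hy h1 h2 => hcon x hx y hy h1 h2) hA
    exact hp ⟨(c, ρ), by simp [hc, hρ], h⟩
  have step4 : ∑ q ∈ permsOn (insert b A) ×ˢ permsOn Aᶜ,
      (if TransOn Finset.univ (q.1 * q.2) then X (q.1 * q.2) else 0) =
      hookSum b A B (fun p => if TransOn (insert b (A ∪ B)) p then 1 else 0) * X 1 := by
    rw [Finset.sum_product, hookSum, hR, Finset.sum_mul]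
    refine Finset.sum_congr rfl fun c hc => ?_
    rw [Finset.sum_mul]
    refine Finset.sum_congr rfl fun ρ hρ => ?_
    dsimp only
    rw [hU, hXl c hc ρ, ← one_mul ρ, hXr ρ (hR ▸ hρ), one_mul]
    split_ifs <;> simp
  rw [step1, step2, ← step3, step4, hookSum_transOn b A B hA hB hAB]
  simp [hX, hookSum]

/-- The distribution of the product of two maximal cycles, tested against `φ`. -/
lemma sum_sum_cyclesOn (b : α) (φ : Perm α → ℤ) :
    (Fintype.card α : ℤ) * ∑ p ∈ cyclesOn Finset.univ, ∑ q ∈ cyclesOn Finset.univ, φ (p * q) =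
      ∑ A ∈ (Finset.univ.erase b).powerset,
        (A.card.factorial : ℤ) * (Finset.univ.erase b \ A).card.factorial *
          hookSum b A (Finset.univ.erase b \ A) φ := by
  have hins : insert b (Finset.univ.erase b) = (Finset.univ : Finset α) :=
    Finset.insert_erase (Finset.mem_univ b)
  have hcard : (Fintype.card α : ℤ) = (Finset.univ.erase b).card + 1 := by
    rw [← Finset.card_univ, ← Finset.card_erase_add_one (Finset.mem_univ b)]
    push_cast
    rfl
  rw [hcard, Finset.mul_sum]
  have h := fun p : Perm α =>
    sum_hookSum b (Finset.univ.erase b) (Finset.notMem_erase b _) fun q => φ (p * q)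
  rw [hins] at h
  simp_rw [← h]
  rw [Finset.sum_comm]
  refine Finset.sum_congr rfl fun A hA => ?_
  have hA' := Finset.mem_powerset.1 hA
  rw [← Finset.mul_sum, sum_cyclesOn_hookSum (fun h => Finset.notMem_erase b _ (hA' h)) (by simp)
    Finset.disjoint_sdiff (by rw [Finset.union_sdiff_of_subset hA', hins]), ← mul_assoc,
    ← mul_assoc, ← mul_assoc, ← mul_pow]
  simp

end ClassSum

/-! ### Evaluation of hook symmetrizers on the separation indicator. -/

section SeparatingHookSum

variable {N t : ℕ} {S : Fin t → Finset (Fin N)}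

open scoped Classical in
/-- The indicator of the permutations that separate the sets `S j`. -/
noncomputable def sepIndicator (S : Fin t → Finset (Fin N)) (σ : Perm (Fin N)) : ℤ :=
  if Separates σ S then 1 else 0

lemma separates_iff {σ : Perm (Fin N)} :
    Separates σ S ↔ ∀ i j x y, x ∈ S i → y ∈ S j → σ.SameCycle x y → i = j := by
  constructor
  · intro h i j x y hx hy hxy
    by_contra hij
    exact h i j hij x hx y hy hxy
  · intro h i j hij x hx y hy hxy
    exact hij (h i j x y hx hy hxy)

lemma separates_swap_mul_of_notMem {p : Perm (Fin N)} {x a : Fin N} (hp : p x = x) (ha : a ≠ x)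
    (hx : ∀ j, x ∉ S j) : Separates (swap x a * p) S ↔ Separates p S := by
  have hne : ∀ j, ∀ y ∈ S j, y ≠ x := fun j y hy h => hx j (h ▸ hy)
  rw [separates_iff, separates_iff]
  refine forall₄_congr fun i j y z => ?_
  refine forall₂_congr fun hy hz => ?_
  rw [sameCycle_swap_mul hp (hne i y hy) (hne j z hz) ha]

lemma eq_of_mem_of_mem (hdisj : ∀ i j, i ≠ j → Disjoint (S i) (S j)) {i j : Fin t} {x : Fin N}
    (hi : x ∈ S i) (hj : x ∈ S j) : i = j := by
  by_contra h
  exact Finset.disjoint_left.1 (hdisj i j h) hi hj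

/-- The inserted point joins the cycle of `a`, and `a` is marked, so separation survives exactly
when both lie in the same block. -/
lemma separates_swap_mul_of_mem (hdisj : ∀ i j, i ≠ j → Disjoint (S i) (S j))
    {p : Perm (Fin N)} {x a : Fin N} {j : Fin t} (hp : p x = x) (ha : a ≠ x) (hx : x ∈ S j)
    (haS : ∃ k, a ∈ S k) :
    Separates (swap x a * p) S ↔ Separates p S ∧ a ∈ S j := by
  have hself := sameCycle_swap_mul_self (a := a) hp
  rw [separates_iff, separates_iff]
  constructor
  · intro h
    refine ⟨fun i k y z hy hz hyz => ?_, ?_⟩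
    · by_cases hyx : y = x
      · subst hyx
        have := hyz.eq_of_left hp
        subst this
        exact eq_of_mem_of_mem hdisj hy hz
      · by_cases hzx : z = x
        · subst hzx
          exact absurd (hyz.eq_of_right hp) hyx
        · exact h i k y z hy hz ((sameCycle_swap_mul hp hyx hzx ha).2 hyz)
    · obtain ⟨k, hk⟩ := haS
      rwa [h j k x a hx hk hself]
  · rintro ⟨h, haj⟩
    have key : ∀ k z, z ∈ S k → (swap x a * p).SameCycle x z → j = k := by
      intro k z hz hxz
      by_cases hzx : z = x
      · subst hzx
        exact eq_of_mem_of_mem hdisj hx hz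
      · exact h j k a z haj hz
          ((sameCycle_swap_mul hp ha hzx ha).1 (hself.symm.trans hxz))
    intro i k y z hy hz hyz
    by_cases hyx : y = x
    · subst hyx
      rw [← key k z hz hyz]
      exact eq_of_mem_of_mem hdisj hy hx
    · by_cases hzx : z = x
      · subst hzx
        rw [← key i y hy hyz.symm]
        exact eq_of_mem_of_mem hdisj hx hz
      · exact h i k y z hy hz ((sameCycle_swap_mul hp hyx hzx ha).1 hyz)

/-- Here `x` lands before `p a`; since `a` and `p a` are marked and share a cycle, separation of `p`
puts them in one block. -/
lemma separates_mul_swap_of_mem (hdisj : ∀ i j, i ≠ j → Disjoint (S i) (S j))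
    {p : Perm (Fin N)} {x a : Fin N} {j : Fin t} (hp : p x = x) (ha : a ≠ x) (hx : x ∈ S j)
    (haS : ∃ k, a ∈ S k) (hpaS : ∃ k, p a ∈ S k) :
    Separates (p * swap x a) S ↔ Separates p S ∧ a ∈ S j := by
  have hpa : p a ≠ x := fun h => ha (p.injective (h.trans hp.symm))
  rw [mul_swap_of_apply_eq_self hp, separates_swap_mul_of_mem hdisj hp hpa hx hpaS]
  refine and_congr_right fun h => ?_
  rw [separates_iff] at h
  have hs : p.SameCycle a (p a) := ⟨1, by simp⟩
  obtain ⟨k, hk⟩ := haS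
  obtain ⟨m, hm⟩ := hpaS
  have hkm := h k m _ _ hk hm hs
  subst hkm
  constructor
  · intro h1
    rwa [← eq_of_mem_of_mem hdisj hm h1]
  · intro h1
    rwa [← eq_of_mem_of_mem hdisj hk h1]

lemma card_insert_inter (hdisj : ∀ i j, i ≠ j → Disjoint (S i) (S j)) {x : Fin N}
    {C : Finset (Fin N)} (hxC : x ∉ C) {j : Fin t} (hx : x ∈ S j) (k : Fin t) :
    (insert x C ∩ S k).card = (C ∩ S k).card + if k = j then 1 else 0 := by
  split_ifs with h
  · subst h
    rw [Finset.insert_inter_of_mem hx, Finset.card_insert_of_notMem]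
    simp [hxC]
  · rw [Finset.insert_inter_of_notMem, add_zero]
    exact fun hk => h (eq_of_mem_of_mem hdisj hk hx)

/-- A marked `x` may be inserted only at points of its own block, so adding it to `A` or `B`
multiplies by 1 minus or plus the number of such points. `b` belongs to both sides, hence is counted
in both intersections. -/
lemma hookSum_sepIndicator_marked (hdisj : ∀ i j, i ≠ j → Disjoint (S i) (S j))
    {b : Fin N} (hb : ∃ k, b ∈ S k) {A B : Finset (Fin N)} (hA : b ∉ A) (hB : b ∉ B)
    (hAB : Disjoint A B) (hAS : ∀ x ∈ A, ∃ k, x ∈ S k) (hBS : ∀ x ∈ B, ∃ k, x ∈ S k) :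
    hookSum b A B (sepIndicator S) =
      ∏ j, ((∏ i ∈ Finset.range (insert b A ∩ S j).card, (1 - (i : ℤ))) *
        ((insert b B ∩ S j).card.factorial : ℤ)) := by
  classical
  have hunion : ∀ A B : Finset (Fin N), (∀ x ∈ A, ∃ k, x ∈ S k) → (∀ x ∈ B, ∃ k, x ∈ S k) →
      ∀ x ∈ insert b (A ∪ B), ∃ k, x ∈ S k := by
    intro A B hAS hBS x hx
    rcases Finset.mem_insert.1 hx with rfl | hx
    · exact hb
    · rcases Finset.mem_union.1 hx with hx | hx
      exacts [hAS x hx, hBS x hx]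
  have hcount : ∀ (C : Finset (Fin N)) (j : Fin t) (P : Prop),
      (∑ a ∈ C, if P ∧ a ∈ S j then (1 : ℤ) else 0) =
        (C ∩ S j).card * if P then 1 else 0 := by
    intro C j P
    by_cases hP : P <;> simp [hP, Finset.sum_ite_mem]
  induction B using Finset.induction_on with
  | empty =>
    induction A using Finset.induction_on with
    | empty =>
      rw [hookSum_empty, sepIndicator, if_pos]
      · symm
        refine Finset.prod_eq_one fun j _ => ?_
        have : (insert b ∅ ∩ S j).card ≤ 1 :=
          (Finset.card_le_card Finset.inter_subset_left).trans (by simp)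
        interval_cases (insert b ∅ ∩ S j).card <;> simp
      · rw [separates_iff]
        intro i j x y hx hy hxy
        rw [Perm.sameCycle_one] at hxy
        subst hxy
        exact eq_of_mem_of_mem hdisj hx hy
    | insert x A hx ih =>
      have hbx : b ≠ x := fun h => hA (h ▸ Finset.mem_insert_self _ _)
      have hbA : b ∉ A := fun h => hA (Finset.mem_insert_of_mem h)
      have hxA : x ∉ insert b A := by simp [hx, hbx.symm]
      obtain ⟨j, hj⟩ := hAS x (Finset.mem_insert_self _ _)
      have hAS' : ∀ x ∈ A, ∃ k, x ∈ S k := fun y hy => hAS y (Finset.mem_insert_of_mem hy)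
      have h1 : ∀ p ∈ permsOn (insert b (A ∪ ∅)),
          sepIndicator S p - ∑ a ∈ insert b A, sepIndicator S (swap x a * p) =
            (1 - ((insert b A ∩ S j).card : ℤ)) * sepIndicator S p := by
        intro p hp
        rw [Finset.union_empty] at hp
        have hpx := mem_permsOn.1 hp x hxA
        simp only [sepIndicator]
        rw [Finset.sum_congr rfl fun a ha => if_congr
          (separates_swap_mul_of_mem hdisj hpx (ne_of_mem_of_not_mem ha hxA) hj
            (hunion A ∅ hAS' hBS a (by simpa using ha))) rfl rfl, hcount]
        ring
      rw [hookSum_insert_left hxA, hookSum_congr h1, hookSum_const_mul,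
        ih hbA hAS' (by simp), Finset.insert_comm b x A]
      have h2 : ∀ k, (∏ i ∈ Finset.range (insert x (insert b A) ∩ S k).card, (1 - (i : ℤ))) *
          ((insert b ∅ ∩ S k).card.factorial : ℤ) =
          (if k = j then (1 - ((insert b A ∩ S j).card : ℤ)) else 1) *
          ((∏ i ∈ Finset.range (insert b A ∩ S k).card, (1 - (i : ℤ))) *
          ((insert b ∅ ∩ S k).card.factorial : ℤ)) := by
        intro k
        rw [card_insert_inter hdisj hxA hj]
        split_ifs with h
        · subst h
          rw [Finset.prod_range_succ]
          ring
        · simp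
      conv_rhs => rw [Finset.prod_congr rfl fun k _ => h2 k, Finset.prod_mul_distrib,
        Finset.prod_ite_eq' Finset.univ j, if_pos (Finset.mem_univ _)]
  | insert x B hx ih =>
    rw [Finset.disjoint_insert_right] at hAB
    have hbx : b ≠ x := fun h => hB (h ▸ Finset.mem_insert_self _ _)
    have hbB : b ∉ B := fun h => hB (Finset.mem_insert_of_mem h)
    have hxB : x ∉ insert b B := by simp [hx, hbx.symm]
    have hxF : x ∉ insert b (A ∪ B) := by simp [hx, hbx.symm, hAB.1]
    obtain ⟨j, hj⟩ := hBS x (Finset.mem_insert_self _ _)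
    have hBS' : ∀ x ∈ B, ∃ k, x ∈ S k := fun y hy => hBS y (Finset.mem_insert_of_mem hy)
    have h1 : ∀ p ∈ permsOn (insert b (A ∪ B)),
        sepIndicator S p + ∑ a ∈ insert b B, sepIndicator S (p * swap x a) =
          (1 + ((insert b B ∩ S j).card : ℤ)) * sepIndicator S p := by
      intro p hp
      have hpx := mem_permsOn.1 hp x hxF
      have hsub : insert b B ⊆ insert b (A ∪ B) :=
        Finset.insert_subset_insert _ Finset.subset_union_right
      simp only [sepIndicator]
      rw [Finset.sum_congr rfl fun a ha => if_congr
        (separates_mul_swap_of_mem hdisj hpx (ne_of_mem_of_not_mem ha hxB) hj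
          (hunion A B hAS hBS' a (hsub ha))
          (hunion A B hAS hBS' _ (apply_mem_of_mem_permsOn hp (hsub ha)))) rfl rfl, hcount]
      ring
    rw [hookSum_insert_right hxB, hookSum_congr h1, hookSum_const_mul,
      ih hbB hAB.2 hBS', Finset.insert_comm b x B]
    have h2 : ∀ k, (∏ i ∈ Finset.range (insert b A ∩ S k).card, (1 - (i : ℤ))) *
        ((insert x (insert b B) ∩ S k).card.factorial : ℤ) =
        (if k = j then (1 + ((insert b B ∩ S j).card : ℤ)) else 1) *
        ((∏ i ∈ Finset.range (insert b A ∩ S k).card, (1 - (i : ℤ))) *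
        ((insert b B ∩ S k).card.factorial : ℤ)) := by
      intro k
      rw [card_insert_inter hdisj hxB hj]
      split_ifs with h
      · subst h
        rw [Nat.factorial_succ]
        push_cast
        ring
      · simp
    conv_rhs => rw [Finset.prod_congr rfl fun k _ => h2 k, Finset.prod_mul_distrib,
      Finset.prod_ite_eq' Finset.univ j, if_pos (Finset.mem_univ _)]

/-- An unmarked point never affects separation, whether fixed or inserted at any of `A.card + 1`
places: the factor is 1 - (`A.card` + 1). On the right it is 1 + (`B.card` + 1). -/
lemma hookSum_sepIndicator_insert_left {b x : Fin N} {A B : Finset (Fin N)} (hA : b ∉ A)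
    (hx : x ∉ insert b (A ∪ B)) (hxS : ∀ j, x ∉ S j) :
    hookSum b (insert x A) B (sepIndicator S) =
      -(A.card : ℤ) * hookSum b A B (sepIndicator S) := by
  classical
  have hxA : x ∉ insert b A :=
    fun h => hx (Finset.insert_subset_insert _ Finset.subset_union_left h)
  rw [hookSum_insert_left hxA, ← hookSum_const_mul]
  refine hookSum_congr fun p hp => ?_
  simp only [sepIndicator]
  rw [Finset.sum_congr rfl fun a ha => if_congr (separates_swap_mul_of_notMem
    (mem_permsOn.1 hp x hx) (ne_of_mem_of_not_mem ha hxA) hxS) rfl rfl, Finset.sum_const,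
    Finset.card_insert_of_notMem hA, nsmul_eq_mul]
  push_cast
  ring

lemma hookSum_sepIndicator_insert_right {b x : Fin N} {A B : Finset (Fin N)} (hB : b ∉ B)
    (hx : x ∉ insert b (A ∪ B)) (hxS : ∀ j, x ∉ S j) :
    hookSum b A (insert x B) (sepIndicator S) =
      (B.card + 2 : ℤ) * hookSum b A B (sepIndicator S) := by
  classical
  have hxB : x ∉ insert b B :=
    fun h => hx (Finset.insert_subset_insert _ Finset.subset_union_right h)
  rw [hookSum_insert_right hxB, ← hookSum_const_mul]
  refine hookSum_congr fun p hp => ?_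
  have hpx := mem_permsOn.1 hp x hx
  have hpa : ∀ a ∈ insert b B, p a ≠ x := fun a ha h =>
    ne_of_mem_of_not_mem ha hxB (p.injective (h.trans hpx.symm))
  simp only [sepIndicator, mul_swap_of_apply_eq_self hpx]
  rw [Finset.sum_congr rfl fun a ha => if_congr (separates_swap_mul_of_notMem
    hpx (hpa a ha) hxS) rfl rfl, Finset.sum_const,
    Finset.card_insert_of_notMem hB, nsmul_eq_mul]
  push_cast
  ring

lemma hookSum_sepIndicator_union {b : Fin N} {A B A' B' : Finset (Fin N)}
    (hdA : Disjoint A A') (hdB : Disjoint B B')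
    (h : Disjoint (A ∪ A') (B ∪ B')) (hbA : b ∉ A ∪ A') (hbB : b ∉ B ∪ B')
    (hA' : ∀ x ∈ A', ∀ j, x ∉ S j) (hB' : ∀ x ∈ B', ∀ j, x ∉ S j) :
    hookSum b (A ∪ A') (B ∪ B') (sepIndicator S) =
      (∏ i ∈ Finset.range A'.card, (-((A.card : ℤ) + i))) *
        (∏ i ∈ Finset.range B'.card, ((B.card : ℤ) + 2 + i)) *
        hookSum b A B (sepIndicator S) := by
  induction B' using Finset.induction_on with
  | empty =>
    induction A' using Finset.induction_on with
    | empty => simp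
    | insert x A' hx ih =>
      rw [Finset.disjoint_insert_right] at hdA
      rw [Finset.union_insert] at hbA h ⊢
      rw [Finset.disjoint_insert_left] at h
      have hbA1 : b ∉ A ∪ A' := fun h => hbA (Finset.mem_insert_of_mem h)
      have hbx : x ≠ b := fun h => hbA (h ▸ Finset.mem_insert_self _ _)
      rw [hookSum_sepIndicator_insert_left hbA1 _ (hA' x (Finset.mem_insert_self _ _)),
        ih hdA.2 hbA1 (fun y hy => hA' y (Finset.mem_insert_of_mem hy)) h.2,
        Finset.card_union_of_disjoint hdA.2, Finset.card_insert_of_notMem hx,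
        Finset.prod_range_succ]
      · push_cast
        ring
      · have := h.1
        simp only [Finset.mem_insert, Finset.mem_union] at *
        tauto
  | insert x B' hx ih =>
    rw [Finset.disjoint_insert_right] at hdB
    rw [Finset.union_insert] at hbB h ⊢
    rw [Finset.disjoint_insert_right] at h
    have hbB1 : b ∉ B ∪ B' := fun h => hbB (Finset.mem_insert_of_mem h)
    have hbx : x ≠ b := fun h => hbB (h ▸ Finset.mem_insert_self _ _)
    rw [hookSum_sepIndicator_insert_right hbB1 _ (hB' x (Finset.mem_insert_self _ _)),
      ih hdB.2 h.2 hbB1 (fun y hy => hB' y (Finset.mem_insert_of_mem hy)),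
      Finset.card_union_of_disjoint hdB.2, Finset.card_insert_of_notMem hx,
      Finset.prod_range_succ]
    · push_cast
      ring
    · have := h.1
      have := hdB.1
      simp only [Finset.mem_insert, Finset.mem_union] at *
      tauto

end SeparatingHookSum

/-! ### Sums over subsets of disjoint unions. -/

section PowersetSums

lemma sum_powerset_union {α β : Type*} [DecidableEq α] [AddCommMonoid β] {F D : Finset α}
    (h : Disjoint F D) (f : Finset α → β) :
    ∑ A ∈ (F ∪ D).powerset, f A = ∑ A ∈ F.powerset, ∑ B ∈ D.powerset, f (A ∪ B) := by
  induction D using Finset.induction_on generalizing f with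
  | empty => simp
  | insert x D hx ih =>
    rw [Finset.disjoint_insert_right] at h
    rw [Finset.union_insert, Finset.sum_powerset_insert (by simp [h.1, hx]), ih h.2,
      ih h.2 fun A => f (insert x A), ← Finset.sum_add_distrib]
    refine Finset.sum_congr rfl fun A _ => ?_
    rw [Finset.sum_powerset_insert hx]
    simp_rw [Finset.union_insert]

lemma sum_powerset_biUnion {α ι K : Type*} [DecidableEq α] [CommSemiring K]
    {D : ι → Finset α} (hD : ∀ i j, i ≠ j → Disjoint (D i) (D j)) (g : ι → ℕ → K)
    (J : Finset ι) :
    ∑ A ∈ (J.biUnion D).powerset, ∏ j ∈ J, g j (A ∩ D j).card =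
      ∏ j ∈ J, ∑ m ∈ Finset.range ((D j).card + 1), ((D j).card.choose m : K) * g j m := by
  classical
  induction J using Finset.induction_on with
  | empty => simp
  | insert k J hk ih =>
    have hdis : Disjoint (D k) (J.biUnion D) := by
      rw [Finset.disjoint_biUnion_right]
      exact fun j hj => hD k j fun h => hk (h ▸ hj)
    rw [Finset.biUnion_insert, sum_powerset_union hdis, Finset.prod_insert hk, ← ih,
      show ∑ m ∈ Finset.range ((D k).card + 1), ((D k).card.choose m : K) * g k m =
        ∑ B ∈ (D k).powerset, g k B.card by
          rw [Finset.sum_powerset_apply_card]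
          simp [nsmul_eq_mul], Finset.sum_mul_sum]
    refine Finset.sum_congr rfl fun A hA => Finset.sum_congr rfl fun B hB => ?_
    rw [Finset.mem_powerset] at hA hB
    rw [Finset.prod_insert hk]
    refine congrArg₂ (· * ·) (congrArg (fun C => g k (Finset.card C)) ?_) ?_
    · rw [Finset.union_inter_distrib_right, Finset.inter_eq_left.2 hA,
        Finset.disjoint_iff_inter_eq_empty.1 (hdis.symm.mono_left hB), Finset.union_empty]
    · refine Finset.prod_congr rfl fun j hj => ?_
      rw [Finset.union_inter_distrib_right, Finset.disjoint_iff_inter_eq_empty.1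
        ((hD k j fun h => hk (h ▸ hj)).mono_left hA), Finset.empty_union]

end PowersetSums

/-! ### Summation over the distributions of the marked points. -/

section MarkedSum

variable {N t : ℕ} {S : Fin t → Finset (Fin N)}

lemma prod_range_one_sub_eq_zero {m : ℕ} (h : 2 ≤ m) :
    ∏ i ∈ Finset.range m, (1 - (i : ℤ)) = 0 :=
  Finset.prod_eq_zero (Finset.mem_range.2 (by omega : 1 < m)) (by simp)

/-- The sum factors over blocks, and at most one point of a block may lie in `insert b A`. In the
block of `b` that point is `b`; in any other, having none gives ℓ_j! Q^ℓ_j and having one gives ℓ_j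
· (ℓ_j-1)! P Q^(ℓ_j-1). `P` and `Q` will be power series, hence the general ring. -/
lemma sum_hookSum_sepIndicator_marked {K : Type*} [CommRing K]
    (hdisj : ∀ i j, i ≠ j → Disjoint (S i) (S j))
    (hne : ∀ j, (S j).Nonempty) {b : Fin N} {j₀ : Fin t} (hb : b ∈ S j₀) (P Q : K)
    {U : Finset (Fin N)} (hU : U = Finset.univ.biUnion fun j => (S j).erase b) :
    ∑ A ∈ U.powerset, (hookSum b A (U \ A) (sepIndicator S) : K) * (P ^ A.card *
      Q ^ (U \ A).card) =
      ∏ j, (((S j).card.factorial : K) * (Q ^ ((S j).card - 1) *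
        if j = j₀ then 1 else P + Q)) := by
  classical
  set D : Fin t → Finset (Fin N) := fun j => (S j).erase b with hDdef
  have hDS : ∀ j, D j ⊆ S j := fun j => Finset.erase_subset _ _
  have hDd : ∀ i j, i ≠ j → Disjoint (D i) (D j) := fun i j h =>
    (hdisj i j h).mono (hDS i) (hDS j)
  have hbU : b ∉ U := by simp [hU, hDdef]
  have hUS : ∀ x ∈ U, ∃ k, x ∈ S k := by
    intro x hx
    rw [hU, Finset.mem_biUnion] at hx
    obtain ⟨j, -, hj⟩ := hx
    exact ⟨j, hDS j hj⟩
  have hbj : ∀ j, b ∈ S j ↔ j = j₀ := fun j =>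
    ⟨fun h => eq_of_mem_of_mem hdisj h hb, fun h => h ▸ hb⟩
  have hinter : ∀ A, b ∉ A → ∀ j, (insert b A ∩ S j).card =
      (A ∩ D j).card + if j = j₀ then 1 else 0 := by
    intro A hA j
    have : A ∩ D j = A ∩ S j := by
      ext y
      simp only [hDdef, Finset.mem_inter, Finset.mem_erase]
      constructor
      · tauto
      · rintro ⟨h1, h2⟩
        exact ⟨h1, fun h => hA (h ▸ h1), h2⟩
    rw [this]
    exact card_insert_inter hdisj hA hb j
  have hcardU : ∀ A ⊆ U, A.card = ∑ j, (A ∩ D j).card := by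
    intro A hA
    rw [← Finset.card_biUnion, ← Finset.inter_biUnion, ← hU, Finset.inter_eq_left.2 hA]
    exact fun i _ j _ h =>
      (hDd i j h).mono Finset.inter_subset_right Finset.inter_subset_right
  have hsd : ∀ A ⊆ U, ∀ j, ((U \ A) ∩ D j).card = (D j).card - (A ∩ D j).card := by
    intro A hA j
    have : (U \ A) ∩ D j = D j \ (A ∩ D j) := by
      ext y
      have : y ∈ D j → y ∈ U := fun h => by
        rw [hU]
        exact Finset.mem_biUnion.2 ⟨j, Finset.mem_univ _, h⟩
      simp only [Finset.mem_inter, Finset.mem_sdiff]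
      tauto
    rw [this, Finset.card_sdiff_of_subset Finset.inter_subset_right]
  set g : Fin t → ℕ → K := fun j m =>
    (((∏ i ∈ Finset.range (m + if j = j₀ then 1 else 0), (1 - (i : ℤ))) : ℤ) : K) *
      (((D j).card - m + if j = j₀ then 1 else 0).factorial : K) *
      (P ^ m * Q ^ ((D j).card - m)) with hg
  have hterm : ∀ A ∈ U.powerset, (hookSum b A (U \ A) (sepIndicator S) : K) * (P ^ A.card *
      Q ^ (U \ A).card) = ∏ j, g j (A ∩ D j).card := by
    intro A hA
    rw [Finset.mem_powerset] at hA
    have hbA : b ∉ A := fun h => hbU (hA h)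
    have hbB : b ∉ U \ A := by simp [hbU]
    rw [hookSum_sepIndicator_marked hdisj ⟨j₀, hb⟩ hbA hbB Finset.disjoint_sdiff
      (fun x hx => hUS x (hA hx)) (fun x hx => hUS x (Finset.sdiff_subset hx)),
      hcardU A hA, hcardU _ Finset.sdiff_subset, ← Finset.prod_pow_eq_pow_sum,
      ← Finset.prod_pow_eq_pow_sum, Int.cast_prod, ← Finset.prod_mul_distrib,
      ← Finset.prod_mul_distrib]
    refine Finset.prod_congr rfl fun j _ => ?_
    rw [hinter A hbA, hinter _ hbB, hsd A hA]
    simp only [hg]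
    push_cast
    ring
  rw [Finset.sum_congr rfl hterm, hU, sum_powerset_biUnion hDd]
  refine Finset.prod_congr rfl fun j _ => ?_
  by_cases hj : j = j₀
  · have hc : (S j).card = (D j).card + 1 :=
      (Finset.card_erase_add_one ((hbj j).2 hj)).symm
    rw [Finset.sum_eq_single_of_mem 0 (by simp)]
    · simp [hg, hj]
      rw [← hj, hc]
      simp
    · intro m _ hm
      have : g j m = 0 := by
        simp only [hg]
        rw [if_pos hj, prod_range_one_sub_eq_zero (by omega)]
        simp
      rw [this, mul_zero]
  · have hDj : D j = S j := Finset.erase_eq_of_notMem fun h => hj ((hbj j).1 h)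
    obtain ⟨d, hd⟩ : ∃ d, (S j).card = d + 1 :=
      ⟨(S j).card - 1, (Nat.succ_pred_eq_of_pos (hne j).card_pos).symm⟩
    rw [Finset.sum_range_succ', Finset.sum_eq_single_of_mem 0 (by simp [hDj, hd])]
    · simp only [hg, hDj, hd, if_neg hj]
      simp [Nat.factorial_succ]
      ring
    · intro m _ hm
      have : g j (m + 1) = 0 := by
        simp only [hg]
        rw [prod_range_one_sub_eq_zero (by omega)]
        simp
      rw [this, mul_zero]

end MarkedSum

/-! ### Binomial series with negative exponents. -/

section GeometricSeries

/-- The power series `1 / (1 - y X)`. -/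
noncomputable def geomSeries (y : ℝ) : ℝ⟦X⟧ := PowerSeries.rescale y (PowerSeries.mk 1)

lemma geomSeries_mul (y : ℝ) : geomSeries y * (1 - PowerSeries.C y * PowerSeries.X) = 1 := by
  have h := congrArg (PowerSeries.rescale y) (PowerSeries.mk_one_mul_one_sub_eq_one ℝ)
  rwa [map_mul, map_sub, map_one, PowerSeries.rescale_X] at h

lemma coeff_geomSeries_pow (y : ℝ) (d k : ℕ) :
    PowerSeries.coeff k (geomSeries y ^ d) =
      y ^ k * (∏ i ∈ Finset.range k, ((d : ℝ) + i)) / (k.factorial : ℝ) := by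
  cases d with
  | zero =>
    cases k with
    | zero => simp
    | succ k => simp [PowerSeries.coeff_one, Finset.prod_range_succ']
  | succ d =>
    rw [geomSeries, ← map_pow, PowerSeries.mk_one_pow_eq_mk_choose_add, PowerSeries.coeff_rescale,
      PowerSeries.coeff_mk, mul_div_assoc]
    congr 1
    rw [eq_div_iff (by positivity)]
    have h : (d + k).choose d * k.factorial = ∏ i ∈ Finset.range k, (d + 1 + i) := by
      rw [← Nat.ascFactorial_eq_prod_range, Nat.ascFactorial_eq_factorial_mul_choose,
        Nat.choose_symm_add, mul_comm]
    exact_mod_cast h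

/-- Partial fractions: over the common denominator the numerator is x(1-yX) + y(1+xX) = x + y. -/
lemma geomSeries_add {x y : ℝ} (h : x + y = 1) :
    PowerSeries.C x * geomSeries (-x) + PowerSeries.C y * geomSeries y =
      geomSeries (-x) * geomSeries y := by
  have h1 := geomSeries_mul (-x)
  have h2 := geomSeries_mul y
  have h3 : PowerSeries.C x + PowerSeries.C y = (1 : ℝ⟦X⟧) := by
    rw [← map_add, h, map_one]
  rw [map_neg] at h1
  linear_combination (-PowerSeries.C x * geomSeries (-x)) * h2 -
    PowerSeries.C y * geomSeries y * h1 + geomSeries (-x) * geomSeries y * h3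

/-- The two rising products, divided by factorials, are coefficients of (1+xX)^(-m) and (1-yX)^(-n);
the sum over subsets is their Cauchy product. -/
lemma sum_powerset_geomSeries {α : Type*} [DecidableEq α] (V : Finset α) (x y : ℝ) (m n : ℕ) :
    ∑ B ∈ V.powerset, (∏ i ∈ Finset.range B.card, (-((m : ℝ) + i))) *
        (∏ i ∈ Finset.range (V \ B).card, ((n : ℝ) + i)) *
        (x ^ B.card * y ^ (V \ B).card) =
      V.card.factorial *
        PowerSeries.coeff V.card (geomSeries (-x) ^ m * geomSeries y ^ n) := by
  set f : ℕ → ℝ := fun k => (∏ i ∈ Finset.range k, (-((m : ℝ) + i))) *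
    (∏ i ∈ Finset.range (V.card - k), ((n : ℝ) + i)) * (x ^ k * y ^ (V.card - k)) with hf
  have h1 : ∀ B ∈ V.powerset, (∏ i ∈ Finset.range B.card, (-((m : ℝ) + i))) *
      (∏ i ∈ Finset.range (V \ B).card, ((n : ℝ) + i)) * (x ^ B.card * y ^ (V \ B).card) =
      f B.card := by
    intro B hB
    rw [Finset.card_sdiff_of_subset (Finset.mem_powerset.1 hB)]
  rw [Finset.sum_congr rfl h1, Finset.sum_powerset_apply_card f, PowerSeries.coeff_mul,
    Finset.Nat.sum_antidiagonal_eq_sum_range_succ_mk, Finset.mul_sum]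
  refine Finset.sum_congr rfl fun k hk => ?_
  have hk' : k ≤ V.card := Nat.lt_succ_iff.1 (Finset.mem_range.1 hk)
  simp only [hf]
  rw [coeff_geomSeries_pow, coeff_geomSeries_pow, nsmul_eq_mul, Nat.cast_choose ℝ hk',
    Finset.prod_neg, neg_pow x, Finset.card_range]
  have e1 : (k.factorial : ℝ) ≠ 0 := by positivity
  have e2 : ((V.card - k).factorial : ℝ) ≠ 0 := by positivity
  field_simp

end GeometricSeries

/-! ### The weighted sum over all hooks as a power series coefficient. -/

section HookPolynomial

variable {N t : ℕ} {S : Fin t → Finset (Fin N)}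

lemma sum_hookSum_sepIndicator (hdisj : ∀ i j, i ≠ j → Disjoint (S i) (S j))
    (hne : ∀ j, (S j).Nonempty) {b : Fin N} {j₀ : Fin t} (hb : b ∈ S j₀) {x y : ℝ}
    (hxy : x + y = 1) {ℓ : ℕ} (hℓ : ℓ = ∑ j, (S j).card) :
    ∑ A ∈ (Finset.univ.erase b).powerset,
      (hookSum b A (Finset.univ.erase b \ A) (sepIndicator S) : ℝ) *
        (x ^ A.card * y ^ (Finset.univ.erase b \ A).card) =
      (N - ℓ).factorial * (∏ j, ((S j).card.factorial : ℝ)) * (y ^ (ℓ - t) *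
        PowerSeries.coeff (N - ℓ) (geomSeries (-x) ^ (t - 1) * geomSeries y ^ (ℓ + 1))) := by
  classical
  set U : Finset (Fin N) := Finset.univ.biUnion fun j => (S j).erase b with hU
  set V : Finset (Fin N) := Finset.univ.filter fun z => ∀ j, z ∉ S j with hV
  have hUV : Disjoint U V := by
    rw [Finset.disjoint_left]
    intro z hz hz'
    simp only [hU, hV, Finset.mem_biUnion, Finset.mem_filter, Finset.mem_erase] at hz hz'
    obtain ⟨j, -, -, hj⟩ := hz
    exact hz'.2 j hj
  have hUVe : Finset.univ.erase b = U ∪ V := by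
    ext z
    simp only [hU, hV, Finset.mem_biUnion, Finset.mem_filter, Finset.mem_erase, Finset.mem_union,
      Finset.mem_univ, true_and, and_true]
    constructor
    · intro hz
      by_cases h : ∀ j, z ∉ S j
      · exact .inr h
      · push Not at h
        obtain ⟨j, hj⟩ := h
        exact .inl ⟨j, hz, hj⟩
    · rintro (⟨j, hz, -⟩ | h)
      · exact hz
      · rintro rfl
        exact h j₀ hb
  have hbUV : b ∉ U ∪ V := hUVe ▸ Finset.notMem_erase b _
  have hcU : U.card + 1 = ℓ := by
    have h1 : insert b U = Finset.univ.biUnion S := by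
      ext z
      simp only [hU, Finset.mem_insert, Finset.mem_biUnion, Finset.mem_univ, true_and,
        Finset.mem_erase]
      constructor
      · rintro (rfl | ⟨j, -, hj⟩)
        exacts [⟨j₀, hb⟩, ⟨j, hj⟩]
      · rintro ⟨j, hj⟩
        by_cases hz : z = b
        · exact .inl hz
        · exact .inr ⟨j, hz, hj⟩
    rw [← Finset.card_insert_of_notMem (fun h => hbUV (Finset.mem_union_left _ h)), h1,
      Finset.card_biUnion (fun i _ j _ h => hdisj i j h), hℓ]
  have hcV : V.card = N - ℓ := by
    have h1 := congrArg Finset.card hUVe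
    rw [Finset.card_erase_of_mem (Finset.mem_univ b), Finset.card_univ, Fintype.card_fin,
      Finset.card_union_of_disjoint hUV] at h1
    omega
  have htℓ : t ≤ ℓ := by
    rw [hℓ]
    calc t = ∑ _j : Fin t, 1 := by simp
      _ ≤ _ := Finset.sum_le_sum fun j _ => (hne j).card_pos
  have ht : 0 < t := Fin.pos j₀
  set px := geomSeries (-x) with hpx
  set py := geomSeries y with hpy
  -- Summing over the unmarked points with the marked part `A` fixed attaches `px` to each point of
  -- `A` and `py` to each point of `U \ A`; the extra `py ^ 2` comes from the 2 in `|B|+2`.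
  have hinner : ∀ A ∈ U.powerset,
      ∑ B ∈ V.powerset, (hookSum b (A ∪ B) (Finset.univ.erase b \ (A ∪ B)) (sepIndicator S) : ℝ) *
        (x ^ (A ∪ B).card * y ^ (Finset.univ.erase b \ (A ∪ B)).card) =
      (N - ℓ).factorial * PowerSeries.coeff (N - ℓ)
        (((hookSum b A (U \ A) (sepIndicator S) : ℤ) : ℝ⟦X⟧) *
          ((PowerSeries.C x * px) ^ A.card * (PowerSeries.C y * py) ^ (U \ A).card) * py ^ 2) := by
    intro A hA
    rw [Finset.mem_powerset] at hA
    have e1 : ((hookSum b A (U \ A) (sepIndicator S) : ℤ) : ℝ⟦X⟧) *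
          ((PowerSeries.C x * px) ^ A.card * (PowerSeries.C y * py) ^ (U \ A).card) * py ^ 2 =
        PowerSeries.C ((hookSum b A (U \ A) (sepIndicator S) : ℝ) *
          (x ^ A.card * y ^ (U \ A).card)) * (px ^ A.card * py ^ ((U \ A).card + 2)) := by
      simp only [map_mul, map_pow, map_intCast]
      ring
    rw [e1, PowerSeries.coeff_C_mul, mul_left_comm, ← hcV, ← sum_powerset_geomSeries,
      Finset.mul_sum]
    refine Finset.sum_congr rfl fun B hB => ?_
    rw [Finset.mem_powerset] at hB
    have hsd : Finset.univ.erase b \ (A ∪ B) = (U \ A) ∪ (V \ B) := by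
      rw [hUVe]
      ext z
      have h1 : z ∈ U → z ∉ V := fun h => Finset.disjoint_left.1 hUV h
      have h2 : z ∈ A → z ∈ U := fun h => hA h
      have h3 : z ∈ B → z ∈ V := fun h => hB h
      simp only [Finset.mem_sdiff, Finset.mem_union]
      tauto
    have hdAB : Disjoint A B := hUV.mono hA hB
    have hdAB' : Disjoint (U \ A) (V \ B) := hUV.mono Finset.sdiff_subset Finset.sdiff_subset
    have hVS : ∀ z ∈ V, ∀ j, z ∉ S j := fun z hz => (Finset.mem_filter.1 hz).2
    rw [hsd, hookSum_sepIndicator_union hdAB hdAB' ?_ ?_ ?_ (fun z hz => hVS z (hB hz))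
      (fun z hz => hVS z (Finset.sdiff_subset hz)), Finset.card_union_of_disjoint hdAB,
      Finset.card_union_of_disjoint hdAB']
    · push_cast
      rw [pow_add, pow_add]
      ring
    · rw [← hsd]
      exact Finset.disjoint_sdiff
    · exact fun h => hbUV (Finset.union_subset_union hA hB h)
    · exact fun h => hbUV (Finset.union_subset_union Finset.sdiff_subset Finset.sdiff_subset h)
  have hprod : ∏ j, (((S j).card.factorial : ℝ⟦X⟧) *
      ((PowerSeries.C y * py) ^ ((S j).card - 1) *
        if j = j₀ then 1 else PowerSeries.C x * px + PowerSeries.C y * py)) =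
      PowerSeries.C ((∏ j, ((S j).card.factorial : ℝ)) * y ^ (ℓ - t)) *
        (py ^ (ℓ - t) * (px * py) ^ (t - 1)) := by
    rw [Finset.prod_mul_distrib, Finset.prod_mul_distrib, Finset.prod_pow_eq_pow_sum,
      geomSeries_add hxy, Finset.prod_ite, Finset.prod_const_one, one_mul, Finset.prod_const]
    have e1 : (Finset.univ.filter fun j => ¬ j = j₀).card = t - 1 := by
      rw [Finset.filter_ne', Finset.card_erase_of_mem (Finset.mem_univ _)]
      simp
    have e2 : ∑ j, ((S j).card - 1) = ℓ - t := by
      have : ∑ j, (((S j).card - 1) + 1) = ℓ := by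
        rw [hℓ]
        exact Finset.sum_congr rfl fun j _ => Nat.sub_add_cancel (hne j).card_pos
      rw [Finset.sum_add_distrib] at this
      simp at this
      omega
    rw [e1, e2]
    simp only [map_mul, map_pow, map_prod, map_natCast]
    ring
  have hpow : py ^ (ℓ - t) * (px * py) ^ (t - 1) * py ^ 2 = px ^ (t - 1) * py ^ (ℓ + 1) := by
    rw [mul_pow, show ℓ + 1 = (ℓ - t) + (t - 1) + 2 by omega, pow_add, pow_add]
    ring
  rw [show (Finset.univ.erase b).powerset = (U ∪ V).powerset by rw [hUVe],
    sum_powerset_union hUV, Finset.sum_congr rfl hinner, ← Finset.mul_sum, ← map_sum,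
    ← Finset.sum_mul, sum_hookSum_sepIndicator_marked hdisj hne hb _ _ hU, hprod,
    mul_assoc, hpow, PowerSeries.coeff_C_mul]
  ring

end HookPolynomial

/-! ### The Beta integral. -/

section BetaIntegral

/-- Integration by parts lowers the exponent of `1 - u`. -/
lemma integral_pow_mul_one_sub_pow (i j : ℕ) :
    ∫ u in (0 : ℝ)..1, u ^ i * (1 - u) ^ j =
      (i.factorial : ℝ) * j.factorial / ((i + j + 1).factorial : ℝ) := by
  induction j generalizing i with
  | zero =>
    simp only [pow_zero, mul_one, integral_pow, Nat.factorial_zero, add_zero]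
    rw [Nat.factorial_succ]
    push_cast
    have : (i.factorial : ℝ) ≠ 0 := by positivity
    field_simp
    rw [one_pow, zero_pow (by omega), sub_zero]
  | succ j ih =>
    have hderiv : ∀ u ∈ Set.uIcc (0 : ℝ) 1,
        HasDerivAt (fun u : ℝ => u ^ (i + 1) * (1 - u) ^ (j + 1))
          ((i + 1) * (u ^ i * (1 - u) ^ (j + 1)) - (j + 1) * (u ^ (i + 1) * (1 - u) ^ j)) u := by
      intro u _
      have h1 := hasDerivAt_pow (i + 1) u
      have h2 := ((hasDerivAt_id u).const_sub 1).pow (j + 1)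
      refine (h1.mul h2).congr_deriv ?_
      simp only [Nat.add_sub_cancel, id, Pi.pow_apply]
      push_cast
      ring
    have hint := intervalIntegral.integral_eq_sub_of_hasDerivAt hderiv
      (Continuous.intervalIntegrable (by fun_prop) _ _)
    rw [intervalIntegral.integral_sub (Continuous.intervalIntegrable (by fun_prop) _ _)
      (Continuous.intervalIntegrable (by fun_prop) _ _), intervalIntegral.integral_const_mul,
      intervalIntegral.integral_const_mul, ih (i + 1)] at hint
    rw [show i + 1 + j + 1 = i + (j + 1) + 1 by ring, Nat.factorial_succ i] at hint
    rw [Nat.factorial_succ j]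
    push_cast at hint ⊢
    simp at hint
    have hi : (i : ℝ) + 1 ≠ 0 := by positivity
    apply mul_left_cancel₀ hi
    rw [sub_eq_zero.1 hint]
    ring

end BetaIntegral

/-! ### Coefficients of the integrand and of its formal integral. -/

section SeriesCoefficients

lemma geomSeries_pow_eq_inv (d : ℕ) :
    ((1 - PowerSeries.X : ℝ⟦X⟧) ^ d)⁻¹ = geomSeries 1 ^ d := by
  symm
  rw [PowerSeries.eq_inv_iff_mul_eq_one (by simp), ← mul_pow]
  have h := geomSeries_mul 1
  rw [map_one, one_mul] at h
  rw [h, one_pow]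

lemma coeff_geomSeries_pow_eq (y : ℝ) (d k : ℕ) :
    PowerSeries.coeff k (geomSeries y ^ d) = y ^ k * PowerSeries.coeff k (geomSeries 1 ^ d) := by
  rw [coeff_geomSeries_pow, coeff_geomSeries_pow]
  simp [mul_div_assoc]

/-- The coefficients of `sepIntegrandSeries`, as polynomials in `u` (for `ℓ ≤ N`, `r ≤ N - ℓ`). -/
noncomputable def sepCoeff (N ℓ t r : ℕ) (u : ℝ) : ℝ :=
  PowerSeries.coeff r (geomSeries (-1) ^ (ℓ + 1)) * (u ^ (ℓ - t + r) * (1 - u) ^ (N - ℓ - r))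

lemma continuous_sepCoeff (N ℓ t r : ℕ) : Continuous (sepCoeff N ℓ t r) := by
  unfold sepCoeff
  fun_prop

/-- Expanding in zu/(1-u) costs `(1 - u) ^ (ℓ + 1 + r)` in the denominator, which `(1 - u) ^ (N +
1)` absorbs because `r ≤ N - ℓ`. -/
lemma coeff_sepIntegrandSeries {N ℓ t r : ℕ} (hℓ : ℓ ≤ N) (hr : r ≤ N - ℓ) {u : ℝ} (hu : u ≠ 1) :
    PowerSeries.coeff r (sepIntegrandSeries N ℓ t u) = sepCoeff N ℓ t r u := by
  have hu' : 1 - u ≠ 0 := sub_ne_zero.2 (Ne.symm hu)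
  have h1 : ((PowerSeries.C (1 - u) + PowerSeries.C u * PowerSeries.X) ^ (ℓ + 1))⁻¹ =
      PowerSeries.C ((1 - u)⁻¹ ^ (ℓ + 1)) * geomSeries (-(u / (1 - u))) ^ (ℓ + 1) := by
    symm
    rw [PowerSeries.eq_inv_iff_mul_eq_one (by simpa using hu'), map_pow, ← mul_pow, ← mul_pow]
    have h := geomSeries_mul (-(u / (1 - u)))
    have h2 : PowerSeries.C (1 - u)⁻¹ * PowerSeries.C (1 - u) = (1 : ℝ⟦X⟧) := by
      rw [← map_mul, inv_mul_cancel₀ hu', map_one]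
    have h3 : PowerSeries.C (u / (1 - u)) = PowerSeries.C u * PowerSeries.C (1 - u)⁻¹ := by
      rw [← map_mul, div_eq_mul_inv]
    rw [map_neg, h3] at h
    rw [show PowerSeries.C (1 - u)⁻¹ * geomSeries (-(u / (1 - u))) *
      (PowerSeries.C (1 - u) + PowerSeries.C u * PowerSeries.X) = 1 by
        linear_combination h + geomSeries (-(u / (1 - u))) * h2, one_pow]
  rw [sepIntegrandSeries, h1, ← mul_assoc, ← map_mul, PowerSeries.coeff_C_mul,
    coeff_geomSeries_pow_eq, sepCoeff, coeff_geomSeries_pow_eq (-1)]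
  rw [show N + 1 = (N - ℓ - r) + r + (ℓ + 1) by omega, neg_pow, div_pow, pow_add, pow_add, pow_add _ (ℓ - t),
    inv_pow]
  have h2 : (1 - u) ^ (ℓ + 1) ≠ 0 := pow_ne_zero _ hu'
  field_simp

lemma ae_ne_one : ∀ᵐ u : ℝ, u ≠ 1 := by
  rw [MeasureTheory.ae_iff]
  simp

lemma coeff_sepIntegralSeries {N ℓ t r : ℕ} (hℓ : ℓ ≤ N) (hr : r ≤ N - ℓ) :
    PowerSeries.coeff r (sepIntegralSeries N ℓ t) = ∫ u in (0 : ℝ)..1, sepCoeff N ℓ t r u := by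
  rw [sepIntegralSeries, PowerSeries.coeff_mk]
  refine intervalIntegral.integral_congr_ae ?_
  filter_upwards [ae_ne_one] with u hu _
  exact coeff_sepIntegrandSeries hℓ hr hu

lemma intervalIntegrable_coeff_sepIntegrandSeries {N ℓ t r : ℕ} (hℓ : ℓ ≤ N) (hr : r ≤ N - ℓ) :
    IntervalIntegrable (fun u => PowerSeries.coeff r (sepIntegrandSeries N ℓ t u))
      MeasureTheory.volume 0 1 := by
  refine ((continuous_sepCoeff N ℓ t r).intervalIntegrable 0 1).congr_ae ?_
  refine MeasureTheory.ae_restrict_of_ae ?_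
  filter_upwards [ae_ne_one] with u hu
  exact (coeff_sepIntegrandSeries hℓ hr hu).symm

/-- This is the substitution X = -z/(1-u), carried out on coefficients so that it also holds at `u =
1`. -/
lemma pow_mul_coeff_geomSeries {N ℓ t : ℕ} (u : ℝ) :
    u ^ (ℓ - t) * PowerSeries.coeff (N - ℓ)
      (geomSeries (-(1 - u)) ^ (t - 1) * geomSeries u ^ (ℓ + 1)) =
    (-1) ^ (N - ℓ) * ∑ q ∈ Finset.HasAntidiagonal.antidiagonal (N - ℓ),
      PowerSeries.coeff q.1 (geomSeries 1 ^ (t - 1)) * sepCoeff N ℓ t q.2 u := by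
  rw [PowerSeries.coeff_mul, Finset.mul_sum, Finset.mul_sum]
  refine Finset.sum_congr rfl fun q hq => ?_
  have hq := Finset.HasAntidiagonal.mem_antidiagonal.1 hq
  rw [sepCoeff, coeff_geomSeries_pow_eq (-(1 - u)), coeff_geomSeries_pow_eq u,
    coeff_geomSeries_pow_eq (-1), show N - ℓ - q.2 = q.1 by omega, ← hq, neg_pow (1 - u),
    pow_add (-1 : ℝ), pow_add u]
  have h1 : ((-1 : ℝ) ^ q.2) * (-1) ^ q.2 = 1 := by rw [← mul_pow]; simp
  generalize PowerSeries.coeff q.2 (geomSeries 1 ^ (ℓ + 1)) = a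
  linear_combination (-((-1) ^ q.1 * PowerSeries.coeff q.1 (geomSeries 1 ^ (t - 1)) *
    a * u ^ (ℓ - t) * u ^ q.2 * (1 - u) ^ q.1)) * h1

lemma integral_pow_mul_coeff_geomSeries {N ℓ t : ℕ} (hℓ : ℓ ≤ N) :
    ∫ u in (0 : ℝ)..1, u ^ (ℓ - t) * PowerSeries.coeff (N - ℓ)
      (geomSeries (-(1 - u)) ^ (t - 1) * geomSeries u ^ (ℓ + 1)) =
    (-1) ^ (N - ℓ) * PowerSeries.coeff (N - ℓ)
        (((1 - PowerSeries.X : ℝ⟦X⟧) ^ (t - 1))⁻¹ * sepIntegralSeries N ℓ t) := by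
  simp_rw [pow_mul_coeff_geomSeries]
  rw [intervalIntegral.integral_const_mul, intervalIntegral.integral_finsetSum,
    geomSeries_pow_eq_inv, PowerSeries.coeff_mul]
  · congr 1
    refine Finset.sum_congr rfl fun q hq => ?_
    have hq := Finset.HasAntidiagonal.mem_antidiagonal.1 hq
    rw [intervalIntegral.integral_const_mul, coeff_sepIntegralSeries hℓ (by omega)]
  · exact fun q _ => ((continuous_sepCoeff N ℓ t q.2).const_mul _).intervalIntegrable 0 1

end SeriesCoefficients

/-! ### The separation probability as a formal coefficient. -/

section Probability

lemma maximalCycles_eq (N : ℕ) : maximalCycles N = cyclesOn Finset.univ := by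
  classical
  ext p
  rw [maximalCycles, mem_cyclesOn_univ, Finset.mem_filter, and_iff_right (Finset.mem_univ _)]
  constructor
  · exact fun h x _ y _ => h.2 (Set.mem_univ x) (Set.mem_univ y)
  · intro h
    exact ⟨by simp, fun x _ y _ => h x (Finset.mem_univ _) y (Finset.mem_univ _)⟩

lemma card_maximalCycles {N : ℕ} (b : Fin N) :
    (maximalCycles N).card = (N - 1).factorial := by
  rw [maximalCycles_eq, ← Finset.insert_erase (Finset.mem_univ b), card_cyclesOn_insert _ _
    (Finset.notMem_erase b _), Finset.card_erase_of_mem (Finset.mem_univ b)]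
  simp

lemma separationProb_eq {N t ℓ : ℕ} {S : Fin t → Finset (Fin N)}
    (hdisj : ∀ i j, i ≠ j → Disjoint (S i) (S j))
    (hne : ∀ j, (S j).Nonempty) {b : Fin N} {j₀ : Fin t} (hb : b ∈ S j₀)
    (hℓ : ℓ = ∑ j, (S j).card) (hℓN : ℓ ≤ N) :
    separationProb S = (-1) ^ (N + ℓ) * (N : ℝ) * (∏ j, ((S j).card.factorial : ℝ)) /
      (N.descFactorial ℓ : ℝ) * PowerSeries.coeff (N - ℓ)
        (((1 - PowerSeries.X : ℝ⟦X⟧) ^ (t - 1))⁻¹ * sepIntegralSeries N ℓ t) := by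
  classical
  have hN : 0 < N := Fin.pos b
  set c := PowerSeries.coeff (N - ℓ)
    (((1 - PowerSeries.X : ℝ⟦X⟧) ^ (t - 1))⁻¹ * sepIntegralSeries N ℓ t) with hc
  set cnt : ℤ := ∑ p ∈ cyclesOn Finset.univ, ∑ q ∈ cyclesOn Finset.univ,
    sepIndicator S (p * q) with hcnt
  have hnum : ((((maximalCycles N ×ˢ maximalCycles N).filter
      fun p => Separates (p.1 * p.2) S).card : ℕ) : ℝ) = (cnt : ℝ) := by
    rw [hcnt, ← Finset.sum_product', maximalCycles_eq, Finset.card_filter]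
    push_cast
    simp only [sepIndicator]
    push_cast
    rfl
  have hmain : (N : ℝ) * cnt = N.factorial * ((N - ℓ).factorial *
      (∏ j, ((S j).card.factorial : ℝ)) * ((-1) ^ (N - ℓ) * c)) := by
    have h1 := congrArg (Int.cast (R := ℝ)) (sum_sum_cyclesOn b (sepIndicator S))
    rw [Fintype.card_fin] at h1
    push_cast at h1
    -- The hook polynomial at x = 1-u, y = u; integrating over u turns its monomials into the
    -- weights |A|! |B|! / N!.
    have h2 := fun u : ℝ => sum_hookSum_sepIndicator hdisj hne hb (sub_add_cancel 1 u) hℓ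
    rw [hc, ← integral_pow_mul_coeff_geomSeries hℓN, ← intervalIntegral.integral_const_mul,
      ← intervalIntegral.integral_congr (fun u _ => h2 u), intervalIntegral.integral_finsetSum]
    · rw [hcnt]
      push_cast
      rw [h1, Finset.mul_sum]
      refine Finset.sum_congr rfl fun A hA => ?_
      have hcard : (Finset.univ.erase b \ A).card + A.card + 1 = N := by
        have := Finset.card_sdiff_add_card_eq_card (Finset.mem_powerset.1 hA)
        rw [this, Finset.card_erase_of_mem (Finset.mem_univ b), Finset.card_univ,
          Fintype.card_fin]
        omega
      rw [intervalIntegral.integral_const_mul]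
      simp_rw [mul_comm ((1 - _ : ℝ) ^ _)]
      rw [integral_pow_mul_one_sub_pow, hcard]
      have : (N.factorial : ℝ) ≠ 0 := by positivity
      field_simp
    · exact fun A _ => Continuous.intervalIntegrable (by fun_prop) _ _
  have hfac : (N.factorial : ℝ) = N * (N - 1).factorial := by
    exact_mod_cast (Nat.mul_factorial_pred hN.ne').symm
  have hdesc : ((N - ℓ).factorial : ℝ) * (N.descFactorial ℓ : ℝ) = N.factorial := by
    exact_mod_cast Nat.factorial_mul_descFactorial hℓN
  have hsign : ((-1 : ℝ)) ^ (N + ℓ) = (-1) ^ (N - ℓ) := by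
    rw [show N + ℓ = (N - ℓ) + 2 * ℓ by omega, pow_add, pow_mul]
    simp
  have hN' : (N : ℝ) ≠ 0 := by positivity
  have hp : ((N - 1).factorial : ℝ) ≠ 0 := by positivity
  have hd : (N.descFactorial ℓ : ℝ) ≠ 0 := by
    intro h
    rw [h, mul_zero] at hdesc
    exact (by positivity : (N.factorial : ℝ) ≠ 0) hdesc.symm
  rw [separationProb, hnum, Finset.card_product, card_maximalCycles b, hsign]
  push_cast
  rw [hfac] at hmain hdesc
  have hcnt' : (cnt : ℝ) = (N - 1).factorial * ((N - ℓ).factorial *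
      (∏ j, ((S j).card.factorial : ℝ)) * ((-1) ^ (N - ℓ) * c)) :=
    mul_left_cancel₀ hN' (by rw [hmain]; ring)
  rw [hcnt', div_mul_eq_mul_div, div_eq_div_iff (by positivity) hd]
  linear_combination ((N - 1).factorial * (∏ j, ((S j).card.factorial : ℝ)) *
    ((-1) ^ (N - ℓ) * c)) * hdesc

end Probability

/-! ### One-sided Taylor expansions and the remainder of (1+w)^(-n). -/

section RightExpansions

open Filter Asymptotics

/-- `F(z)` has the Taylor expansion `φ` up to `o(z^m)` as `z → 0`, `z ≥ 0`. -/
def HasRightExpansion (F : ℝ → ℝ) (m : ℕ) (φ : ℝ⟦X⟧) : Prop :=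
  (fun z : ℝ => F z - (PowerSeries.trunc (m + 1) φ).eval z) =o[𝓝[≥] 0] fun z : ℝ => z ^ m

lemma eval_trunc (φ : ℝ⟦X⟧) (n : ℕ) (z : ℝ) :
    (PowerSeries.trunc n φ).eval z =
      ∑ r ∈ Finset.range n, PowerSeries.coeff r φ * z ^ r := by
  exact PowerSeries.eval₂_trunc_eq_sum_range z (RingHom.id ℝ) n φ

lemma HasRightExpansion.hasRightTaylorCoeff {F : ℝ → ℝ} {m : ℕ} {φ : ℝ⟦X⟧}
    (h : HasRightExpansion F m φ) : HasRightTaylorCoeff F m (PowerSeries.coeff m φ) := by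
  refine ⟨fun r => PowerSeries.coeff r φ, rfl, ?_⟩
  simpa only [HasRightExpansion, eval_trunc] using h

lemma isLittleO_pow_succ_mul (m : ℕ) {h : ℝ → ℝ} (hh : ContinuousAt h 0) :
    (fun z : ℝ => z ^ (m + 1) * h z) =o[𝓝[≥] 0] fun z : ℝ => z ^ m := by
  have h1 : (fun z : ℝ => z * h z) =o[𝓝[≥] 0] fun _ : ℝ => (1 : ℝ) := by
    rw [isLittleO_one_iff]
    have : ContinuousAt (fun z : ℝ => z * h z) 0 := continuousAt_id.mul hh
    simpa [ContinuousAt] using this.tendsto.mono_left (nhdsWithin_le_nhds (s := Set.Ici 0))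
  have h2 := (isBigO_refl (fun z : ℝ => z ^ m) (𝓝[≥] 0)).mul_isLittleO h1
  refine (h2.congr_left fun z => ?_).congr_right fun z => mul_one _
  ring

lemma isBigO_one_of_continuous {h : ℝ → ℝ} (hh : Continuous h) :
    h =O[𝓝[≥] 0] fun _ : ℝ => (1 : ℝ) :=
  (hh.tendsto 0).isBigO_one ℝ |>.mono nhdsWithin_le_nhds

lemma HasRightExpansion.mul {F G : ℝ → ℝ} {m : ℕ} {φ ψ : ℝ⟦X⟧}
    (hF : HasRightExpansion F m φ) (hG : HasRightExpansion G m ψ) :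
    HasRightExpansion (fun z => F z * G z) m (φ * ψ) := by
  set P := PowerSeries.trunc (m + 1) φ with hP
  set Q := PowerSeries.trunc (m + 1) ψ with hQ
  -- The product of the truncations agrees with the truncated product up to degree `m`; the excess
  -- is a multiple of z^(m+1).
  obtain ⟨R, hR⟩ : Polynomial.X ^ (m + 1) ∣ P * Q - PowerSeries.trunc (m + 1) (φ * ψ) := by
    rw [Polynomial.X_pow_dvd_iff]
    intro d hd
    rw [Polynomial.coeff_sub, PowerSeries.coeff_trunc, if_pos hd,
      PowerSeries.coeff_mul_eq_coeff_trunc_mul_trunc _ _ hd, ← Polynomial.coe_mul,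
      Polynomial.coeff_coe, sub_self]
  have hpow : (fun z : ℝ => z ^ m) =O[𝓝[≥] 0] fun _ : ℝ => (1 : ℝ) :=
    isBigO_one_of_continuous (by fun_prop)
  have hGO : G =O[𝓝[≥] 0] fun _ : ℝ => (1 : ℝ) := by
    have h1 := (hG.isBigO.trans hpow).add (isBigO_one_of_continuous Q.continuous)
    exact h1.congr_left fun z => by simp [hQ]
  have e1 : (fun z => (F z - P.eval z) * G z) =o[𝓝[≥] 0] fun z : ℝ => z ^ m :=
    (hF.mul_isBigO hGO).congr_right fun z => mul_one _
  have e2 : (fun z => P.eval z * (G z - Q.eval z)) =o[𝓝[≥] 0] fun z : ℝ => z ^ m :=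
    ((isBigO_one_of_continuous P.continuous).mul_isLittleO hG).congr_right fun z => one_mul _
  have e3 := isLittleO_pow_succ_mul m R.continuous.continuousAt
  refine ((e1.add e2).add e3).congr_left fun z => ?_
  have := congrArg (Polynomial.eval z) hR
  simp only [Polynomial.eval_sub, Polynomial.eval_mul, Polynomial.eval_pow,
    Polynomial.eval_X] at this
  linear_combination -this

lemma hasRightExpansion_inv_one_sub_pow (m d : ℕ) :
    HasRightExpansion (fun z => ((1 - z)⁻¹) ^ d) m (geomSeries 1 ^ d) := by
  induction d with
  | zero =>
    simp only [HasRightExpansion, pow_zero]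
    refine (isLittleO_zero _ _).congr_left fun z => ?_
    rw [eval_trunc, Finset.sum_eq_single_of_mem 0 (by simp)]
    · simp
    · intro r _ hr
      simp [PowerSeries.coeff_one, hr]
  | succ d ih =>
    simp only [pow_succ]
    refine ih.mul ?_
    have h1 : ContinuousAt (fun z : ℝ => (1 - z)⁻¹) 0 :=
      ContinuousAt.inv₀ (by fun_prop) (by simp)
    -- The geometric remainder is exactly z^(m+1)/(1-z).
    refine (isLittleO_pow_succ_mul m h1).congr' ?_ EventuallyEq.rfl
    have h2 : ∀ᶠ z : ℝ in 𝓝[≥] 0, z ≠ 1 :=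
      nhdsWithin_le_nhds (isOpen_ne.mem_nhds (by norm_num))
    filter_upwards [h2] with z hz
    rw [eval_trunc]
    have h3 : ∀ r, PowerSeries.coeff r (geomSeries 1) = 1 := by
      intro r
      simp [geomSeries]
    simp only [h3, one_mul]
    rw [geom_sum_eq hz]
    have h4 : 1 - z ≠ 0 := sub_ne_zero.2 (Ne.symm hz)
    have h5 : z - 1 ≠ 0 := sub_ne_zero.2 hz
    field_simp
    ring

/-- The Taylor remainder of `(1 + w)^(-n)`. -/
noncomputable def invPowRemainder (n m : ℕ) (w : ℝ) : ℝ :=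
  ((1 + w)⁻¹) ^ n -
    ∑ r ∈ Finset.range (m + 1), PowerSeries.coeff r (geomSeries (-1) ^ n) * w ^ r

lemma coeff_geomSeries_neg_one_pow_succ (n r : ℕ) :
    PowerSeries.coeff (r + 1) (geomSeries (-1) ^ (n + 1)) =
      PowerSeries.coeff (r + 1) (geomSeries (-1) ^ n) -
        PowerSeries.coeff r (geomSeries (-1) ^ (n + 1)) := by
  have h : geomSeries (-1) ^ (n + 1) * (1 + PowerSeries.X) = geomSeries (-1) ^ n := by
    have h1 := geomSeries_mul (-1)
    rw [map_neg, map_one] at h1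
    linear_combination geomSeries (-1) ^ n * h1
  rw [← h, mul_add, mul_one, map_add, PowerSeries.coeff_succ_mul_X]
  ring

lemma coeff_zero_geomSeries_pow (y : ℝ) (n : ℕ) :
    PowerSeries.coeff 0 (geomSeries y ^ n) = 1 := by
  simp [coeff_geomSeries_pow]

lemma invPowRemainder_succ_succ (n m : ℕ) {w : ℝ} (hw : 0 ≤ w) :
    invPowRemainder (n + 1) (m + 1) w =
      invPowRemainder n (m + 1) w - w * invPowRemainder (n + 1) m w := by
  have h1 : (1 + w)⁻¹ ^ (n + 1) = (1 + w)⁻¹ ^ n - w * (1 + w)⁻¹ ^ (n + 1) := by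
    have : 1 + w ≠ 0 := by positivity
    rw [pow_succ]
    field_simp
    ring
  simp only [invPowRemainder]
  rw [Finset.sum_range_succ', Finset.sum_range_succ' (n := m + 1)]
  simp only [coeff_geomSeries_neg_one_pow_succ n, coeff_zero_geomSeries_pow, sub_mul,
    Finset.sum_sub_distrib]
  have h2 : ∑ r ∈ Finset.range (m + 1),
      PowerSeries.coeff r (geomSeries (-1) ^ (n + 1)) * w ^ (r + 1) =
      w * ∑ r ∈ Finset.range (m + 1),
        PowerSeries.coeff r (geomSeries (-1) ^ (n + 1)) * w ^ r := by
    rw [Finset.mul_sum]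
    exact Finset.sum_congr rfl fun r _ => by ring
  rw [h2]
  linear_combination h1

/-- One constant must serve all `w ≥ 0`: the power `m` is the useful bound for large `w`, `m + 1`
for small `w`. The recursion coming from multiplication by 1+w propagates both. -/
lemma exists_abs_invPowRemainder_le (n m : ℕ) :
    ∃ K : ℝ, 0 ≤ K ∧ ∀ w : ℝ, 0 ≤ w →
      |invPowRemainder n m w| ≤ K * w ^ m ∧ |invPowRemainder n m w| ≤ K * w ^ (m + 1) := by
  induction n generalizing m with
  | zero =>
    refine ⟨0, le_rfl, fun w _ => ?_⟩
    have : invPowRemainder 0 m w = 0 := by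
      rw [invPowRemainder, Finset.sum_eq_single_of_mem 0 (by simp)]
      · simp
      · intro r _ hr
        simp [PowerSeries.coeff_one, hr]
    simp [this]
  | succ n ih =>
    induction m with
    | zero =>
      obtain ⟨K, hK, h⟩ := ih 0
      refine ⟨K + 1, by positivity, fun w hw => ?_⟩
      have e : invPowRemainder (n + 1) 0 w =
          invPowRemainder n 0 w - w * (1 + w)⁻¹ ^ (n + 1) := by
        have : 1 + w ≠ 0 := by positivity
        simp only [invPowRemainder, zero_add, Finset.sum_range_one, coeff_zero_geomSeries_pow]
        rw [pow_succ]
        field_simp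
        ring
      have h0 : 0 ≤ (1 + w)⁻¹ := by positivity
      have h1 : (1 + w)⁻¹ ≤ 1 := inv_le_one_of_one_le₀ (by linarith)
      have hp : (1 + w)⁻¹ ^ n ≤ 1 := pow_le_one₀ h0 h1
      have hp' : (1 + w)⁻¹ ^ (n + 1) ≤ 1 := pow_le_one₀ h0 h1
      have h2 : w * (1 + w)⁻¹ ^ (n + 1) ≤ w := mul_le_of_le_one_right hw hp'
      have h3 : w * (1 + w)⁻¹ ^ (n + 1) ≤ 1 := by
        have : w * (1 + w)⁻¹ ≤ 1 := by
          rw [← div_eq_mul_inv, div_le_one (by positivity)]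
          linarith
        calc w * (1 + w)⁻¹ ^ (n + 1) = (w * (1 + w)⁻¹) * (1 + w)⁻¹ ^ n := by ring
          _ ≤ 1 := mul_le_one₀ this (by positivity) hp
      have h4 : 0 ≤ w * (1 + w)⁻¹ ^ (n + 1) := by positivity
      have h5 := abs_sub (invPowRemainder n 0 w) (w * (1 + w)⁻¹ ^ (n + 1))
      rw [← e, abs_of_nonneg h4] at h5
      obtain ⟨h6, h7⟩ := h w hw
      constructor
      · rw [add_mul]
        simp only [pow_zero, mul_one] at h6 ⊢
        linarith
      · rw [add_mul]
        simp only [zero_add, pow_one, one_mul] at h7 ⊢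
        linarith
    | succ m ihm =>
      obtain ⟨K, hK, h⟩ := ih (m + 1)
      obtain ⟨L, hL, h'⟩ := ihm
      refine ⟨K + L, by positivity, fun w hw => ?_⟩
      have h5 := abs_sub (invPowRemainder n (m + 1) w) (w * invPowRemainder (n + 1) m w)
      rw [← invPowRemainder_succ_succ n m hw, abs_mul, abs_of_nonneg hw] at h5
      obtain ⟨h6, h7⟩ := h w hw
      obtain ⟨h8, h9⟩ := h' w hw
      have h10 := mul_le_mul_of_nonneg_left h8 hw
      have h11 := mul_le_mul_of_nonneg_left h9 hw
      constructor
      · calc _ ≤ _ := h5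
          _ ≤ K * w ^ (m + 1) + w * (L * w ^ m) := add_le_add h6 h10
          _ = _ := by ring
      · calc _ ≤ _ := h5
          _ ≤ K * w ^ (m + 1 + 1) + w * (L * w ^ (m + 1)) := add_le_add h7 h11
          _ = _ := by ring

end RightExpansions

/-! ### Expansion of the integral at z = 0. -/

section IntegralExpansion

open Filter Asymptotics MeasureTheory

lemma sepIntegrand_sub_sum {N ℓ t : ℕ} (hℓ : ℓ ≤ N) {z u : ℝ} (hz : 0 ≤ z) (hu0 : 0 ≤ u)
    (hu1 : u < 1) :
    sepIntegrand N ℓ t z u - ∑ r ∈ Finset.range (N - ℓ + 1), sepCoeff N ℓ t r u * z ^ r =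
      u ^ (ℓ - t) * (1 - u) ^ (N - ℓ) *
        invPowRemainder (ℓ + 1) (N - ℓ) (z * u / (1 - u)) := by
  have hu : 0 < 1 - u := sub_pos.2 hu1
  have h1 : (1 + z * u / (1 - u))⁻¹ = (1 - u) / (1 - u + z * u) := by
    have : 0 < 1 - u + z * u := by positivity
    field_simp
  rw [invPowRemainder, mul_sub, h1, Finset.mul_sum]
  congr 1
  · rw [sepIntegrand, show N + 1 = (N - ℓ) + (ℓ + 1) by omega, pow_add, div_pow]
    ring
  · refine Finset.sum_congr rfl fun r hr => ?_
    have hr' : r ≤ N - ℓ := Nat.lt_succ_iff.1 (Finset.mem_range.1 hr)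
    obtain ⟨k, hk⟩ := Nat.exists_eq_add_of_le hr'
    rw [sepCoeff, hk, Nat.add_sub_cancel_left, div_pow, mul_pow, pow_add u, pow_add (1 - u)]
    field_simp

lemma intervalIntegrable_sepIntegrand {N ℓ t : ℕ} (hℓ : ℓ ≤ N) {z : ℝ} (hz : 0 ≤ z) :
    IntervalIntegrable (sepIntegrand N ℓ t z) volume 0 1 := by
  -- Only for `z = 0` does the denominator vanish on [0,1], at `u = 1`; there the factor cancels
  -- almost everywhere.
  rcases hz.eq_or_lt with rfl | hz
  · have hc : Continuous fun u : ℝ => (1 - u) ^ (N - ℓ) * u ^ (ℓ - t) := by fun_prop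
    refine (hc.intervalIntegrable 0 1).congr_ae (ae_restrict_of_ae ?_)
    filter_upwards [ae_ne_one] with u hu
    have hu' : 1 - u ≠ 0 := sub_ne_zero.2 (Ne.symm hu)
    rw [sepIntegrand, show N + 1 = (N - ℓ) + (ℓ + 1) by omega, zero_mul, add_zero,
      pow_add (1 - u) (N - ℓ) (ℓ + 1)]
    have : (1 - u) ^ (ℓ + 1) ≠ 0 := pow_ne_zero _ hu'
    field_simp
  · refine ContinuousOn.intervalIntegrable ?_
    unfold sepIntegrand
    refine ContinuousOn.div (by fun_prop) (by fun_prop) fun u hu => pow_ne_zero _ ?_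
    rw [Set.uIcc_of_le zero_le_one] at hu
    rcases hu.2.eq_or_lt with rfl | h
    · simpa using hz.ne'
    · have : 0 < 1 - u := sub_pos.2 h
      have := mul_nonneg hz.le hu.1
      positivity

lemma intervalIntegrable_one_sub_rpow :
    IntervalIntegrable (fun u : ℝ => (1 - u) ^ (-(1 / 2) : ℝ)) volume 0 1 := by
  have h := (intervalIntegral.intervalIntegrable_rpow' (a := 0) (b := 1)
    (r := (-(1 / 2) : ℝ)) (by norm_num)).comp_sub_left 1
  simpa using h.symm

lemma abs_sepIntegrand_sub_sum_le {N ℓ t : ℕ} (hℓ : ℓ ≤ N) :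
    ∃ K : ℝ, 0 ≤ K ∧ ∀ z : ℝ, 0 ≤ z → ∀ u : ℝ, 0 ≤ u → u < 1 →
      |sepIntegrand N ℓ t z u - ∑ r ∈ Finset.range (N - ℓ + 1), sepCoeff N ℓ t r u * z ^ r| ≤
        K * z ^ (N - ℓ) * √z * (1 - u) ^ (-(1 / 2) : ℝ) := by
  obtain ⟨K, hK, h⟩ := exists_abs_invPowRemainder_le (ℓ + 1) (N - ℓ)
  refine ⟨K, hK, fun z hz u hu0 hu1 => ?_⟩
  have hu : 0 < 1 - u := sub_pos.2 hu1
  set w := z * u / (1 - u) with hw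
  have hw0 : 0 ≤ w := by positivity
  obtain ⟨h1, h2⟩ := h w hw0
  -- Comparing `w` with 1 merges the two bounds into the half-integer power.
  have h3 : |invPowRemainder (ℓ + 1) (N - ℓ) w| ≤ K * w ^ (N - ℓ) * √w := by
    rcases le_total w 1 with hw1 | hw1
    · calc _ ≤ K * w ^ (N - ℓ + 1) := h2
        _ = K * w ^ (N - ℓ) * w := by ring
        _ ≤ _ := by
          gcongr
          exact Real.le_sqrt_of_sq_le (by nlinarith)
    · calc _ ≤ K * w ^ (N - ℓ) := h1
        _ = K * w ^ (N - ℓ) * 1 := (mul_one _).symm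
        _ ≤ _ := by
          gcongr
          exact Real.one_le_sqrt.2 hw1
  have h4 : √w ≤ √z * (1 - u) ^ (-(1 / 2) : ℝ) := by
    rw [Real.rpow_neg hu.le, ← Real.sqrt_eq_rpow, ← Real.sqrt_inv, ← Real.sqrt_mul hz]
    apply Real.sqrt_le_sqrt
    rw [hw, div_eq_mul_inv]
    have := mul_le_of_le_one_right hz hu1.le
    gcongr
  rw [sepIntegrand_sub_sum hℓ hz hu0 hu1, abs_mul, abs_of_nonneg (by positivity)]
  -- The prefactor cancels the poles of `w ^ (N - ℓ)`, leaving only the integrable singularity of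
  -- `√w`.
  have h5 : (1 - u) ^ (N - ℓ) * w ^ (N - ℓ) = z ^ (N - ℓ) * u ^ (N - ℓ) := by
    rw [← mul_pow, ← mul_pow, hw, mul_div_cancel₀ _ hu.ne']
  have h6 : u ^ (ℓ - t) * u ^ (N - ℓ) ≤ 1 :=
    mul_le_one₀ (pow_le_one₀ hu0 hu1.le) (by positivity) (pow_le_one₀ hu0 hu1.le)
  calc _ ≤ u ^ (ℓ - t) * (1 - u) ^ (N - ℓ) * (K * w ^ (N - ℓ) * √w) := by gcongr
    _ = (u ^ (ℓ - t) * u ^ (N - ℓ)) * (K * z ^ (N - ℓ) * √w) := by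
      linear_combination (u ^ (ℓ - t) * K * √w) * h5
    _ ≤ 1 * (K * z ^ (N - ℓ) * √w) := by gcongr
    _ = K * z ^ (N - ℓ) * √w := one_mul _
    _ ≤ K * z ^ (N - ℓ) * (√z * (1 - u) ^ (-(1 / 2) : ℝ)) := by gcongr
    _ = _ := by ring

lemma hasRightExpansion_integral_sepIntegrand {N ℓ : ℕ} (t : ℕ) (hℓ : ℓ ≤ N) :
    HasRightExpansion (fun z => ∫ u in (0 : ℝ)..1, sepIntegrand N ℓ t z u) (N - ℓ)
      (sepIntegralSeries N ℓ t) := by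
  obtain ⟨K, hK, hbound⟩ := abs_sepIntegrand_sub_sum_le (t := t) hℓ
  set J := ∫ u in (0 : ℝ)..1, (1 - u) ^ (-(1 / 2) : ℝ) with hJ
  have key : ∀ z : ℝ, 0 ≤ z →
      ‖(∫ u in (0 : ℝ)..1, sepIntegrand N ℓ t z u) -
        (PowerSeries.trunc (N - ℓ + 1) (sepIntegralSeries N ℓ t)).eval z‖ ≤
      K * J * ‖z ^ (N - ℓ) * √z‖ := by
    intro z hz
    have e1 : (∫ u in (0 : ℝ)..1, sepIntegrand N ℓ t z u) -
        (PowerSeries.trunc (N - ℓ + 1) (sepIntegralSeries N ℓ t)).eval z =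
        ∫ u in (0 : ℝ)..1, (sepIntegrand N ℓ t z u -
          ∑ r ∈ Finset.range (N - ℓ + 1), sepCoeff N ℓ t r u * z ^ r) := by
      have hc : ∀ r, Continuous fun u => sepCoeff N ℓ t r u * z ^ r :=
        fun r => (continuous_sepCoeff N ℓ t r).mul_const _
      rw [intervalIntegral.integral_sub (intervalIntegrable_sepIntegrand hℓ hz)
        ((continuous_finsetSum _ fun r _ => hc r).intervalIntegrable _ _),
        intervalIntegral.integral_finsetSum fun r _ => (hc r).intervalIntegrable _ _, eval_trunc]
      congr 1
      refine Finset.sum_congr rfl fun r hr => ?_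
      rw [intervalIntegral.integral_mul_const,
        coeff_sepIntegralSeries hℓ (Nat.lt_succ_iff.1 (Finset.mem_range.1 hr))]
    rw [e1, Real.norm_of_nonneg (by positivity : 0 ≤ z ^ (N - ℓ) * √z)]
    have h := intervalIntegral.norm_integral_le_of_norm_le (μ := volume) zero_le_one
      (f := fun u => sepIntegrand N ℓ t z u -
          ∑ r ∈ Finset.range (N - ℓ + 1), sepCoeff N ℓ t r u * z ^ r)
      (g := fun u => K * z ^ (N - ℓ) * √z * (1 - u) ^ (-(1 / 2) : ℝ)) (by
        filter_upwards [ae_ne_one] with u hu hmem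
        exact hbound z hz u hmem.1.le (lt_of_le_of_ne hmem.2 hu))
      (intervalIntegrable_one_sub_rpow.const_mul _)
    refine h.trans (le_of_eq ?_)
    rw [intervalIntegral.integral_const_mul, ← hJ]
    ring
  refine IsBigO.trans_isLittleO (g := fun z : ℝ => z ^ (N - ℓ) * √z)
    (IsBigO.of_bound (K * J) ?_) ?_
  · filter_upwards [self_mem_nhdsWithin] with z hz
    exact key z hz
  · have h1 : (fun z : ℝ => √z) =o[𝓝[≥] 0] fun _ : ℝ => (1 : ℝ) := by
      rw [isLittleO_one_iff]
      have := (Real.continuous_sqrt.tendsto 0).mono_left (nhdsWithin_le_nhds (s := Set.Ici 0))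
      simpa using this
    exact ((isBigO_refl (fun z : ℝ => z ^ (N - ℓ)) (𝓝[≥] 0)).mul_isLittleO h1).congr_right
      fun z => mul_one _

end IntegralExpansion

theorem mainTheorem9 (N t ℓ : ℕ) (ht : 1 ≤ t) (S : Fin t → Finset (Fin N))
    (hne : ∀ j, (S j).Nonempty)
    (hdisj : ∀ i j, i ≠ j → Disjoint (S i) (S j))
    (hℓ : ℓ = ∑ j, (S j).card) :
    -- the integral converges for every real `z ≥ 0`
    (∀ z : ℝ, 0 ≤ z →
      IntervalIntegrable (sepIntegrand N ℓ t z) MeasureTheory.volume 0 1) ∧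
    -- so do the integrals of its coefficients of `z ^ r` for every `r ≤ N - ℓ`
    (∀ r ≤ N - ℓ, IntervalIntegrable
      (fun u => PowerSeries.coeff r (sepIntegrandSeries N ℓ t u)) MeasureTheory.volume 0 1) ∧
    ∃ c : ℝ,
      -- `c` is the coefficient of `z ^ (N - ℓ)`, as a function of `z ≥ 0` and formally
      HasRightTaylorCoeff
        (fun z => (1 - z) ^ (-(t : ℤ) + 1) * ∫ u in (0 : ℝ)..1, sepIntegrand N ℓ t z u)
        (N - ℓ) c ∧
      c = PowerSeries.coeff (N - ℓ)
        (((1 - PowerSeries.X : ℝ⟦X⟧) ^ (t - 1))⁻¹ * sepIntegralSeries N ℓ t) ∧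
      separationProb S =
        (-1) ^ (N + ℓ) * (N : ℝ) * (∏ j, ((S j).card.factorial : ℝ)) /
          (N.descFactorial ℓ : ℝ) * c := by
  have hℓN : ℓ ≤ N := by
    rw [hℓ, ← Finset.card_biUnion (fun i _ j _ h => hdisj i j h)]
    simpa using Finset.card_le_univ (Finset.univ.biUnion S)
  -- The base point of the hooks is taken in a block, here the first; this exempts one block from
  -- the factor P+Q and produces the exponent `t - 1`.
  obtain ⟨b, hb⟩ := hne ⟨0, ht⟩
  refine ⟨fun z hz => intervalIntegrable_sepIntegrand hℓN hz,
    fun r hr => intervalIntegrable_coeff_sepIntegrandSeries hℓN hr, _, ?_, rfl,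
    separationProb_eq hdisj hne hb hℓ hℓN⟩
  have h := ((hasRightExpansion_inv_one_sub_pow (N - ℓ) (t - 1)).mul
    (hasRightExpansion_integral_sepIntegrand t hℓN)).hasRightTaylorCoeff
  rw [geomSeries_pow_eq_inv]
  have hpow : ∀ z : ℝ, (1 - z) ^ (-(t : ℤ) + 1) = ((1 - z)⁻¹) ^ (t - 1) := by
    intro z
    rw [show -(t : ℤ) + 1 = -((t - 1 : ℕ) : ℤ) by omega, zpow_neg, zpow_natCast, inv_pow]
  simpa only [hpow] using h
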